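/- Let $X$ be a complex Banach space and let $A$ be the generator of a $C_0$-semigroup on $X$. Write $\sigma(A)$ for the spectrum of $A$, $R(\lambda,A)=(\lambda-A)^{-1}$ for the resolvent, and $K=\{t\in\mathbb R : it\in\sigma(A)\}$. Assume that there are $a>0$ and $\theta>\tfrac12$ with $$K\subset(-a,a)\qquad\text{and}\qquad \sup\{|t|^{\theta}\,\|R(it,A)\| : t\in\mathbb R,\ |t|\ge a\}<\infty .$$ For $\phi\in L^\infty(\mathbb R,X)$ the Beurling spectrum $sp(\phi)$ is the set of all $\omega\in\mathbb R$ such that every $f\in L^1(\mathbb R,\mathbb C)$ with $f*\phi=0$ satisfies $\int_{\mathbb R}f(t)e^{-i\omega t}\,dt=0$. Then for every closed set $F\subset\mathbb R\setminus K$ there exists $G\in L^1(\mathbb R,L(X))$ (Bochner integrable with respect to the operator norm on the algebra $L(X)$ of bounded linear operators on $X$) such that, for every $\phi\in L^\infty(\mathbb R,X)$ with $sp(\phi)\subset F$, the Bochner integral $u(t)=(G*\phi)(t)=\int_{\mathbb R}G(s)\phi(t-s)\,ds$ exists for every $t\in\mathbb R$, the function $u$ is bounded and uniformly continuous on $\mathbb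 R$, $sp(u)\subset sp(\phi)$, and $u$ is a mild solution of $u'=Au+\phi$ on $\mathbb R$; that is, $u$ is continuous and, for every $t\in\mathbb R$, $\int_0^t u(s)\,ds\in D(A)$ and $$u(t)=u(0)+A\int_0^t u(s)\,ds+\int_0^t\phi(s)\,ds .$$ -/

import Mathlib

open MeasureTheory Filter Topology Set
open scoped NNReal ENNReal

/-- A `C₀`-semigroup `(T(t))_{t ≥ 0}` of bounded linear operators on a complex normed space. -/
structure C0Semigroup (X : Type*) [NormedAddCommGroup X] [NormedSpace ℂ X] where
  /-- the family of operators -/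
  T : ℝ≥0 → X →L[ℂ] X
  map_zero' : T 0 = ContinuousLinearMap.id ℂ X
  map_add' : ∀ s t : ℝ≥0, T (s + t) = (T s).comp (T t)
  strongly_continuous : ∀ x : X, Continuous fun t : ℝ≥0 => T t x

namespace C0Semigroup

variable {X : Type*} [NormedAddCommGroup X] [NormedSpace ℂ X]

/-- `S.HasGenValue x y` says that `y = lim_{t ↓ 0} (T(t) x - x) / t`. -/
def HasGenValue (S : C0Semigroup X) (x y : X) : Prop :=
  Tendsto (fun t : ℝ≥0 => (((t : ℝ) : ℂ)⁻¹) • (S.T t x - x)) (𝓝[>] 0) (𝓝 y)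

theorem HasGenValue.unique {S : C0Semigroup X} {x y z : X}
    (hy : S.HasGenValue x y) (hz : S.HasGenValue x z) : y = z :=
  tendsto_nhds_unique hy hz

theorem HasGenValue.add {S : C0Semigroup X} {x y x' y' : X}
    (h : S.HasGenValue x y) (h' : S.HasGenValue x' y') :
    S.HasGenValue (x + x') (y + y') := by
  refine (Tendsto.add h h').congr fun t => ?_
  rw [← smul_add, map_add]
  congr 1
  abel

theorem HasGenValue.smul {S : C0Semigroup X} {x y : X} (c : ℂ)
    (h : S.HasGenValue x y) : S.HasGenValue (c • x) (c • y) := by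
  refine (Tendsto.const_smul h c).congr fun t => ?_
  rw [map_smul, ← smul_sub, smul_comm]

theorem HasGenValue.zero (S : C0Semigroup X) : S.HasGenValue 0 0 := by
  simp [HasGenValue]

/-- The (infinitesimal) generator `A : D(A) → X` of a `C₀`-semigroup: `D(A)` is the set of `x`
for which `lim_{t ↓ 0} (T(t) x - x) / t` exists, and `A x` is this limit. -/
noncomputable def generator (S : C0Semigroup X) : X →ₗ.[ℂ] X where
  domain :=
    { carrier := {x | ∃ y, S.HasGenValue x y}
      add_mem' := fun ⟨y, hy⟩ ⟨z, hz⟩ => ⟨y + z, hy.add hz⟩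
      zero_mem' := ⟨0, HasGenValue.zero S⟩
      smul_mem' := fun c _ ⟨y, hy⟩ => ⟨c • y, hy.smul c⟩ }
  toFun :=
    { toFun := fun x => Classical.choose x.2
      map_add' := fun x x' =>
        (Classical.choose_spec (x + x').2).unique
          ((Classical.choose_spec x.2).add (Classical.choose_spec x'.2))
      map_smul' := fun c x =>
        (Classical.choose_spec (c • x).2).unique ((Classical.choose_spec x.2).smul c) }

theorem mem_generator_domain (S : C0Semigroup X) (x : X) :
    x ∈ S.generator.domain ↔ ∃ y, S.HasGenValue x y := Iff.rfl

theorem hasGenValue_generator (S : C0Semigroup X) (x : S.generator.domain) :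
    S.HasGenValue (x : X) (S.generator x) := Classical.choose_spec x.2

end C0Semigroup

namespace UnboundedOp

variable {X : Type*} [NormedAddCommGroup X] [NormedSpace ℂ X]

/-- The bounded operator `R` is the inverse `(z - A)⁻¹` of `z - A : D(A) → X`. -/
def IsResolvent (A : X →ₗ.[ℂ] X) (z : ℂ) (R : X →L[ℂ] X) : Prop :=
  (∀ x : X, ∃ h : R x ∈ A.domain, z • R x - A ⟨R x, h⟩ = x) ∧
    ∀ x : A.domain, R (z • (x : X) - A x) = x

theorem IsResolvent.unique {A : X →ₗ.[ℂ] X} {z : ℂ} {R R' : X →L[ℂ] X}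
    (h : IsResolvent A z R) (h' : IsResolvent A z R') : R = R' := by
  ext x
  obtain ⟨hx, hx'⟩ := h'.1 x
  have := h.2 ⟨R' x, hx⟩
  rwa [hx'] at this

/-- The spectrum `σ(A)` of an unbounded operator: all `z` for which `z - A : D(A) → X` has no
bounded everywhere defined inverse. -/
def spec (A : X →ₗ.[ℂ] X) : Set ℂ := {z | ¬ ∃ R : X →L[ℂ] X, IsResolvent A z R}

open Classical in
/-- The resolvent `R(z, A) = (z - A)⁻¹ ∈ L(X)` for `z ∉ σ(A)` (and the value `0` for
`z ∈ σ(A)`). -/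
noncomputable def resolv (A : X →ₗ.[ℂ] X) (z : ℂ) : X →L[ℂ] X :=
  if h : ∃ R : X →L[ℂ] X, IsResolvent A z R then Classical.choose h else 0

theorem isResolvent_resolv {A : X →ₗ.[ℂ] X} {z : ℂ} (hz : z ∉ spec A) :
    IsResolvent A z (resolv A z) := by
  have h : ∃ R : X →L[ℂ] X, IsResolvent A z R := not_not.mp hz
  rw [resolv, dif_pos h]
  exact Classical.choose_spec h

/-- The set `K = {t ∈ ℝ : i t ∈ σ(A)}`. -/
def imagSpec (A : X →ₗ.[ℂ] X) : Set ℝ := {t | Complex.I * (t : ℂ) ∈ spec A}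

/-- `u : ℝ → X` is a mild solution on `ℝ` of `u' = A u + φ`, with `φ` locally integrable:
`u` is continuous, `∫_0^t u(s) ds ∈ D(A)` and
`u(t) = u(0) + A ∫_0^t u(s) ds + ∫_0^t φ(s) ds` for all `t ∈ ℝ`. -/
def IsMildSolution (A : X →ₗ.[ℂ] X) (φ u : ℝ → X) : Prop :=
  LocallyIntegrable φ volume ∧ Continuous u ∧
    ∀ t : ℝ, ∃ h : (∫ s in (0 : ℝ)..t, u s) ∈ A.domain,
      u t = u 0 + A ⟨∫ s in (0 : ℝ)..t, u s, h⟩ + ∫ s in (0 : ℝ)..t, φ s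

end UnboundedOp

section Beurling

variable {X : Type*} [NormedAddCommGroup X] [NormedSpace ℂ X]

/-- The Fourier transform `f^(ω) = ∫ f(t) e^{-iωt} dt`. -/
noncomputable def fourierL1 (f : ℝ → ℂ) (ω : ℝ) : ℂ :=
  ∫ t : ℝ, f t * Complex.exp (-(Complex.I * (ω : ℂ) * (t : ℂ)))

/-- The convolution `(f * φ)(t) = ∫ f(s) φ(t - s) ds` of a scalar function `f` with an
`X`-valued function `φ`. -/
noncomputable def scalarConv (f : ℝ → ℂ) (φ : ℝ → X) : ℝ → X :=
  convolution f φ (ContinuousLinearMap.lsmul ℂ ℂ) volume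

/-- The convolution `(G * φ)(t) = ∫ G(s) φ(t - s) ds` of an `L(X)`-valued function `G` with an
`X`-valued function `φ`. -/
noncomputable def opConv (G : ℝ → X →L[ℂ] X) (φ : ℝ → X) : ℝ → X :=
  convolution G φ (ContinuousLinearMap.id ℂ (X →L[ℂ] X)) volume

/-- The Beurling spectrum of `φ ∈ L^∞(ℝ, X)`: all `ω ∈ ℝ` such that every `f ∈ L^1(ℝ, ℂ)` with
`f * φ = 0` satisfies `f^(ω) = 0`. -/
def beurlingSpectrum (φ : ℝ → X) : Set ℝ :=
  {ω | ∀ f : ℝ → ℂ, Integrable f volume → scalarConv f φ = 0 → fourierL1 f ω = 0}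

end Beurling

/-! On the Fourier side a bounded solution should be `R(iω, A)` times the transform of `φ`. Only
frequencies in `F` matter, so the resolvent may be altered near `K`. With `ω = 2πξ`, take a smooth
compactly supported `ψ`, equal to 1 near `K` and supported off `F`, and consider the smooth symbol
`H = (1 - ψ) R(2πiξ, A)`.

`H` is the transform of an integrable `G` (`exists_integrable_fourier_eq_freqResolv`). `H` itself
may fail to be integrable, but outside a compact set each derivative of `H` of order 1, 2, 3 is a
constant times a power at least 2 of the resolvent, hence `O(|ξ|^(-2θ))` with `2θ > 1`. One inverts
`H'` and divides by `-2πix`: the third derivative gives decay at infinity, and the spare exponent in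
`2θ > 1` tames the singularity at 0 (`exists_integrable_fourier_eq`).

The error made by the cutoff is `m * φ`, where `m` is the inverse transform of `ψ`. It vanishes
because `supp ψ` misses `sp(φ)`: a Bernstein-type estimate shows this locally
(`eq_zero_of_bernstein`), and a partition of unity globalises it (`scalarConv_fourierInv_eq_zero`).

The mild equation is then an identity between `L¹` kernels, checked on transforms with the resolvent
identity (`isMildSolution_opConv`). Boundedness, uniform continuity and the spectral inclusion hold
for any convolution with an `L¹` kernel. -/

open scoped FourierTransform Convolution SchwartzMap

/-! ### Continuity of translation in `L¹` -/

section Translation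

variable {E : Type*} [NormedAddCommGroup E]

theorem continuous_integral_norm_translate_sub {f : ℝ → E} (hf : Integrable f) :
    Continuous fun h : ℝ => ∫ x, ‖f (h + x) - f x‖ := by
  have : Fact ((1 : ℝ≥0∞) ≠ ⊤) := ⟨by simp⟩
  have hm : MemLp f 1 volume := memLp_one_iff_integrable.mpr hf
  have hc : Continuous fun h : ℝ => DomAddAct.mk h +ᵥ hm.toLp f :=
    DomAddAct.mkHomeomorph.continuous.vadd continuous_const
  have hn : Continuous fun h : ℝ => ‖(DomAddAct.mk h +ᵥ hm.toLp f) - hm.toLp f‖ :=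
    (hc.sub continuous_const).norm
  refine hn.congr fun h => ?_
  have hh : Integrable fun x => f (h + x) - f x := (hf.comp_add_left h).sub hf
  rw [DomAddAct.mk_vadd_toLp, ← MemLp.toLp_sub]
  exact L1.norm_of_fun_eq_integral_norm hh

end Translation

/-! ### Uniqueness for the Fourier transform of vector-valued functions -/

section FourierInjective

variable {E : Type*} [NormedAddCommGroup E] [NormedSpace ℂ E]

theorem fourier_sub_apply {f g : ℝ → E} (hf : Integrable f) (hg : Integrable g) (ξ : ℝ) :
    𝓕 (f - g) ξ = 𝓕 f ξ - 𝓕 g ξ := by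
  simp only [Real.fourier_eq, Pi.sub_apply, smul_sub]
  exact integral_sub ((Real.fourierIntegral_convergent_iff ξ).mpr hf)
    ((Real.fourierIntegral_convergent_iff ξ).mpr hg)

theorem fourier_const_smul_apply (c : ℂ) (f : ℝ → E) (ξ : ℝ) :
    𝓕 (c • f) ξ = c • 𝓕 f ξ := by
  simp only [Real.fourier_eq, Pi.smul_apply, ← integral_smul]
  exact integral_congr_ae (Eventually.of_forall fun v => smul_comm _ _ _)

variable [CompleteSpace E]

theorem ae_eq_zero_of_fourier_eq_zero {f : ℝ → E} (hf : Integrable f) (h : 𝓕 f = 0) :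
    f =ᵐ[volume] 0 := by
  refine ae_eq_zero_of_integral_contDiff_smul_eq_zero hf.locallyIntegrable fun g hg hgc => ?_
  have hg₁ : HasCompactSupport (Complex.ofRealCLM ∘ g) := hgc.comp_left rfl
  have hg₂ : ContDiff ℝ (⊤ : ℕ∞) (Complex.ofRealCLM ∘ g) := by fun_prop
  set k : SchwartzMap ℝ ℂ := hg₁.toSchwartzMap hg₂
  -- The test function is itself a Fourier transform, so the transform can be moved onto `f`, where
  -- it is zero.
  have key := VectorFourier.integral_fourierIntegral_smul_eq_flip (μ := volume) (ν := volume)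
    (L := innerₗ ℝ) (f := (𝓕⁻ k : SchwartzMap ℝ ℂ)) (g := f) Real.continuous_fourierChar
    continuous_inner (𝓕⁻ k : SchwartzMap ℝ ℂ).integrable hf
  have h1 : ∀ x, VectorFourier.fourierIntegral 𝐞 volume (innerₗ ℝ).flip f x = 0 := fun x => by
    rw [flip_innerₗ]
    exact congrFun h x
  have h2 : VectorFourier.fourierIntegral 𝐞 volume (innerₗ ℝ) (𝓕⁻ k : SchwartzMap ℝ ℂ) = k := by
    change 𝓕 (⇑(𝓕⁻ k : SchwartzMap ℝ ℂ)) = k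
    rw [← SchwartzMap.fourier_coe, FourierTransform.fourier_fourierInv_eq]
  simp only [h1, h2, smul_zero, integral_zero] at key
  simpa [k] using key

theorem ae_eq_of_fourier_eq {f g : ℝ → E} (hf : Integrable f) (hg : Integrable g)
    (h : ∀ ξ, 𝓕 f ξ = 𝓕 g ξ) : f =ᵐ[volume] g := by
  have h0 : 𝓕 (f - g) = 0 := by
    ext ξ
    rw [fourier_sub_apply hf hg, h, sub_self]
    rfl
  filter_upwards [ae_eq_zero_of_fourier_eq_zero (hf.sub hg) h0] with x hx
  exact sub_eq_zero.mp hx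

end FourierInjective

/-! ### Convolution of `L¹` operator kernels with bounded functions -/

section OpConv

variable {X : Type*} [NormedAddCommGroup X]

theorem memLp_comp_sub_left {φ : ℝ → X} (hφ : MemLp φ ⊤ volume) (t : ℝ) :
    MemLp (fun s => φ (t - s)) ⊤ volume :=
  hφ.comp_measurePreserving (Measure.measurePreserving_sub_left volume t)

theorem ae_norm_comp_sub_left_le {φ : ℝ → X} (hφ : MemLp φ ⊤ volume) (t : ℝ) :
    ∀ᵐ s, ‖φ (t - s)‖ ≤ (eLpNorm φ ⊤ volume).toReal := by
  have h1 : ∀ᵐ s, ‖φ s‖ ≤ (eLpNorm φ ⊤ volume).toReal := by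
    filter_upwards [ae_le_eLpNormEssSup (f := φ) (μ := volume)] with s hs
    rw [← toReal_enorm]
    exact ENNReal.toReal_mono hφ.2.ne hs
  exact (Measure.measurePreserving_sub_left volume t).quasiMeasurePreserving.ae h1

variable [NormedSpace ℂ X]

theorem opConv_apply (a : ℝ → X →L[ℂ] X) (φ : ℝ → X) (t : ℝ) :
    opConv a φ t = ∫ s, a s (φ (t - s)) := rfl

theorem integrable_opConv_integrand {a : ℝ → X →L[ℂ] X} {φ : ℝ → X} (ha : Integrable a)
    (hφ : MemLp φ ⊤ volume) (t : ℝ) : Integrable fun s => a s (φ (t - s)) := by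
  have hm := (memLp_comp_sub_left hφ t).1
  refine (ha.norm.mul_const (eLpNorm φ ⊤ volume).toReal).mono'
    ((ContinuousLinearMap.id ℂ (X →L[ℂ] X)).aestronglyMeasurable_comp₂ ha.1 hm) ?_
  filter_upwards [ae_norm_comp_sub_left_le hφ t] with s hs
  exact (a s).le_of_opNorm_le_of_le le_rfl hs

theorem norm_opConv_le {a : ℝ → X →L[ℂ] X} {φ : ℝ → X} (ha : Integrable a)
    (hφ : MemLp φ ⊤ volume) (t : ℝ) :
    ‖opConv a φ t‖ ≤ (∫ s, ‖a s‖) * (eLpNorm φ ⊤ volume).toReal := by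
  rw [opConv_apply, ← integral_mul_const]
  refine norm_integral_le_of_norm_le (ha.norm.mul_const _) ?_
  filter_upwards [ae_norm_comp_sub_left_le hφ t] with s hs
  exact (a s).le_of_opNorm_le_of_le le_rfl hs

theorem opConv_congr_ae {a b : ℝ → X →L[ℂ] X} (h : a =ᵐ[volume] b) (φ : ℝ → X) (t : ℝ) :
    opConv a φ t = opConv b φ t := by
  refine integral_congr_ae ?_
  filter_upwards [h] with s hs
  simp [hs]

theorem opConv_add {a b : ℝ → X →L[ℂ] X} {φ : ℝ → X} (ha : Integrable a) (hb : Integrable b)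
    (hφ : MemLp φ ⊤ volume) (t : ℝ) :
    opConv (a + b) φ t = opConv a φ t + opConv b φ t := by
  simp only [opConv_apply]
  rw [← integral_add (integrable_opConv_integrand ha hφ t) (integrable_opConv_integrand hb hφ t)]
  rfl

theorem opConv_sub {a b : ℝ → X →L[ℂ] X} {φ : ℝ → X} (ha : Integrable a) (hb : Integrable b)
    (hφ : MemLp φ ⊤ volume) (t : ℝ) :
    opConv (a - b) φ t = opConv a φ t - opConv b φ t := by
  simp only [opConv_apply]
  rw [← integral_sub (integrable_opConv_integrand ha hφ t) (integrable_opConv_integrand hb hφ t)]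
  rfl

theorem opConv_const_smul (c : ℂ) (a : ℝ → X →L[ℂ] X) (φ : ℝ → X) (t : ℝ) :
    opConv (c • a) φ t = c • opConv a φ t := by
  simp only [opConv_apply]
  rw [← integral_smul]
  rfl

theorem opConv_const_mul [CompleteSpace X] (R : X →L[ℂ] X) {a : ℝ → X →L[ℂ] X} {φ : ℝ → X}
    (ha : Integrable a) (hφ : MemLp φ ⊤ volume) (t : ℝ) :
    opConv (fun s => R * a s) φ t = R (opConv a φ t) := by
  simp only [opConv_apply]
  rw [← R.integral_comp_comm (integrable_opConv_integrand ha hφ t)]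
  rfl

theorem opConv_translate (a : ℝ → X →L[ℂ] X) (φ : ℝ → X) (t h : ℝ) :
    opConv (fun s => a (h + s)) φ t = opConv a φ (h + t) := by
  simp only [opConv_apply]
  rw [← integral_add_left_eq_self (fun s => a s (φ (h + t - s))) h]
  simp

/-- A shift of the convolution can be put on the kernel, where translation is continuous in `L¹`;
`φ` need not be continuous. -/
theorem uniformContinuous_opConv {a : ℝ → X →L[ℂ] X} {φ : ℝ → X} (ha : Integrable a)
    (hφ : MemLp φ ⊤ volume) : UniformContinuous (opConv a φ) := by
  set C := (eLpNorm φ ⊤ volume).toReal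
  have hlim : Tendsto (fun h : ℝ => (∫ x, ‖a (h + x) - a x‖) * C) (𝓝 0) (𝓝 0) := by
    have := ((continuous_integral_norm_translate_sub ha).mul_const C).tendsto 0
    simpa using this
  have hb : ∀ h t, ‖opConv a φ (h + t) - opConv a φ t‖ ≤ (∫ x, ‖a (h + x) - a x‖) * C := by
    intro h t
    have hah := ha.comp_add_left h
    rw [← opConv_translate, ← opConv_sub hah ha hφ]
    exact norm_opConv_le (hah.sub ha) hφ t
  rw [Metric.uniformContinuous_iff]
  intro ε hε
  obtain ⟨δ, hδ, H⟩ := Metric.eventually_nhds_iff.mp (hlim.eventually_lt_const hε)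
  refine ⟨δ, hδ, fun {x y} hxy => ?_⟩
  rw [dist_eq_norm]
  have := hb (x - y) y
  rw [sub_add_cancel] at this
  exact this.trans_lt (H (by simpa [dist_eq_norm] using hxy))

theorem memLp_opConv {a : ℝ → X →L[ℂ] X} {φ : ℝ → X} (ha : Integrable a)
    (hφ : MemLp φ ⊤ volume) : MemLp (opConv a φ) ⊤ volume :=
  memLp_top_of_bound (uniformContinuous_opConv ha hφ).continuous.aestronglyMeasurable _
    (Eventually.of_forall (norm_opConv_le ha hφ))

/-- Associativity by Fubini. As `φ` is essentially bounded, it holds at every `t`, not merely almost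
everywhere. -/
theorem opConv_convolution [CompleteSpace X] {a b : ℝ → X →L[ℂ] X} {φ : ℝ → X}
    (ha : Integrable a) (hb : Integrable b) (hφ : MemLp φ ⊤ volume) (t : ℝ) :
    opConv (a ⋆[ContinuousLinearMap.mul ℂ (X →L[ℂ] X)] b) φ t = opConv a (opConv b φ) t := by
  have hn : MemLp (fun x => ‖φ x‖) ⊤ volume := hφ.norm
  set C := (eLpNorm φ ⊤ volume).toReal
  have hbφ : ∀ x, Integrable fun s => ‖b s‖ * ‖φ (x - s)‖ := fun x => by
    refine (hb.norm.mul_const C).mono' (hb.norm.1.mul (memLp_comp_sub_left hφ x).norm.1) ?_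
    filter_upwards [ae_norm_comp_sub_left_le hφ x] with s hs
    rw [Real.norm_of_nonneg (by positivity)]
    gcongr
  have hm : AEStronglyMeasurable
      ((fun x => ‖b x‖) ⋆[ContinuousLinearMap.mul ℝ ℝ] fun x => ‖φ x‖) volume :=
    (hb.norm.1.convolution_integrand (ContinuousLinearMap.mul ℝ ℝ) hφ.norm.1).integral_prod_right'
  have hbd : ∀ x, ‖((fun x => ‖b x‖) ⋆[ContinuousLinearMap.mul ℝ ℝ] fun x => ‖φ x‖) x‖
      ≤ (∫ s, ‖b s‖) * C := fun x => by
    rw [← integral_mul_const]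
    refine norm_integral_le_of_norm_le (hb.norm.mul_const C) ?_
    filter_upwards [ae_norm_comp_sub_left_le hφ x] with s hs
    simp only [ContinuousLinearMap.mul_apply', norm_mul, norm_norm]
    gcongr
  refine convolution_assoc _ _ _ _ (fun x y z => rfl) ha.1 hb.1 hφ.1
    (ha.ae_convolution_exists _ hb) (Eventually.of_forall hbφ) ?_
  refine (ha.norm.mul_const ((∫ s, ‖b s‖) * C)).mono' (ha.norm.1.mul (hm.comp_measurePreserving
    (Measure.measurePreserving_sub_left volume t))) (Eventually.of_forall fun s => ?_)
  simp only [ContinuousLinearMap.mul_apply', norm_mul, norm_norm]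
  exact mul_le_mul_of_nonneg_left (hbd _) (norm_nonneg _)

theorem opConv_eq_of_fourier_eq [CompleteSpace X] {a b : ℝ → X →L[ℂ] X} (ha : Integrable a)
    (hb : Integrable b) (h : ∀ ξ, 𝓕 a ξ = 𝓕 b ξ) (φ : ℝ → X) (t : ℝ) :
    opConv a φ t = opConv b φ t :=
  opConv_congr_ae (ae_eq_of_fourier_eq ha hb h) φ t

theorem scalarConv_eq_opConv (f : ℝ → ℂ) (φ : ℝ → X) :
    scalarConv f φ = opConv (fun s => f s • (1 : X →L[ℂ] X)) φ := rfl

theorem fourier_smul_const [CompleteSpace X] (f : ℝ → ℂ) (B : X →L[ℂ] X) (ξ : ℝ) :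
    𝓕 (fun s => f s • B) ξ = 𝓕 f ξ • B := by
  simp only [Real.fourier_eq]
  exact (integral_congr_ae (Eventually.of_forall fun v => (smul_assoc _ _ _).symm)).trans
    (integral_smul_const (fun v => 𝐞 (-inner ℝ v ξ) • f v) B)

theorem fourier_const_mul [CompleteSpace X] (B : X →L[ℂ] X) {a : ℝ → X →L[ℂ] X}
    (ha : Integrable a) (ξ : ℝ) : 𝓕 (fun s => B * a s) ξ = B * 𝓕 a ξ := by
  simp only [Real.fourier_eq]
  rw [← integral_const_mul_of_integrable ((Real.fourierIntegral_convergent_iff ξ).mpr ha)]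
  simp only [mul_smul_comm]

theorem fourier_mul_convolution [CompleteSpace X] {a b : ℝ → X →L[ℂ] X}
    (ha : Integrable a) (hb : Integrable b) (ξ : ℝ) :
    𝓕 (a ⋆[ContinuousLinearMap.mul ℂ (X →L[ℂ] X)] b) ξ = 𝓕 a ξ * 𝓕 b ξ :=
  Real.fourier_mul_convolution_eq ha hb ξ

/-- Both iterated convolutions come from kernels whose transforms are the two products, so
uniqueness reduces the claim to pointwise commutation. -/
theorem opConv_comm [CompleteSpace X] {a b : ℝ → X →L[ℂ] X} {φ : ℝ → X} (ha : Integrable a)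
    (hb : Integrable b) (hab : ∀ ξ, Commute (𝓕 a ξ) (𝓕 b ξ)) (hφ : MemLp φ ⊤ volume) (t : ℝ) :
    opConv a (opConv b φ) t = opConv b (opConv a φ) t := by
  rw [← opConv_convolution ha hb hφ, ← opConv_convolution hb ha hφ]
  refine opConv_eq_of_fourier_eq (ha.integrable_convolution _ hb) (hb.integrable_convolution _ ha)
    (fun ξ => ?_) φ t
  rw [fourier_mul_convolution ha hb, fourier_mul_convolution hb ha, (hab ξ).eq]

end OpConv

/-! ### From a decaying smooth symbol to an integrable kernel -/

section SymbolToKernel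

/-- Interpolation between the Lipschitz bound `2π|y|` and the trivial bound 2. -/
theorem norm_fourierChar_sub_one_le {ε : ℝ} (hε : 0 < ε) (hε1 : ε ≤ 1) (y : ℝ) :
    ‖(𝐞 y : ℂ) - 1‖ ≤ 2 * (2 * Real.pi * |y|) ^ ε := by
  have h1 : ‖(𝐞 y : ℂ) - 1‖ ≤ 2 * Real.pi * |y| := by
    rw [Real.fourierChar_apply]
    have := Real.norm_exp_I_mul_ofReal_sub_one_le (x := 2 * Real.pi * y)
    rw [mul_comm] at this
    refine this.trans_eq ?_
    rw [Real.norm_eq_abs, abs_mul, abs_of_pos Real.two_pi_pos]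
  have h2 : ‖(𝐞 y : ℂ) - 1‖ ≤ 2 := by
    refine (norm_sub_le _ _).trans ?_
    rw [Circle.norm_coe, norm_one]
    norm_num
  set z := 2 * Real.pi * |y|
  have hz : 0 ≤ z := by positivity
  rcases le_total z 1 with h | h
  · have := Real.rpow_le_rpow_of_exponent_ge' hz h hε.le hε1
    rw [Real.rpow_one] at this
    have : 0 ≤ z ^ ε := by positivity
    linarith
  · have := Real.one_le_rpow h hε.le
    linarith

theorem intervalIntegrable_abs_rpow {r : ℝ} (hr : -1 < r) (a b : ℝ) :
    IntervalIntegrable (fun x : ℝ => |x| ^ r) volume a b := by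
  have := (intervalIntegral.intervalIntegrable_cpow' (r := (r : ℂ)) (a := a) (b := b)
    (by simpa using hr)).norm
  refine this.congr ?_
  exact fun x _ => by simp [Complex.norm_cpow_real]

variable {E : Type*} [NormedAddCommGroup E] [NormedSpace ℂ E]

theorem sq_mul_norm_fourier_le {D : ℝ → E} (hD : ContDiff ℝ 2 D) (h0 : Integrable D)
    (h1 : Integrable (deriv D)) (h2 : Integrable (deriv (deriv D))) (x : ℝ) :
    x ^ 2 * ‖𝓕 D x‖ ≤ ∫ ξ, ‖deriv (deriv D) ξ‖ := by
  have hd : Differentiable ℝ D := hD.differentiable (by norm_num)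
  have hd' : Differentiable ℝ (deriv D) := by
    have := hD.differentiable_iteratedDeriv 1 (by norm_num)
    rwa [iteratedDeriv_one] at this
  have h3 : 𝓕 (deriv (deriv D)) x =
      (2 * Real.pi * Complex.I * x) • (2 * Real.pi * Complex.I * x) • 𝓕 D x := by
    rw [Real.fourier_deriv h1 hd' h2]
    simp only [Real.fourier_deriv h0 hd h1]
  have h4 : ‖𝓕 (deriv (deriv D)) x‖ ≤ ∫ ξ, ‖deriv (deriv D) ξ‖ :=
    VectorFourier.norm_fourierIntegral_le_integral_norm 𝐞 volume (innerₗ ℝ) _ x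
  have h5 : ‖(2 * Real.pi * Complex.I * x : ℂ)‖ = 2 * Real.pi * |x| := by
    simp [abs_of_pos Real.pi_pos]
  refine le_trans ?_ h4
  rw [h3, norm_smul, norm_smul, h5, ← mul_assoc, ← sq_abs]
  gcongr
  have : 1 ≤ 2 * Real.pi := by linarith [Real.pi_gt_three]
  have hx : |x| ≤ 2 * Real.pi * |x| := le_mul_of_one_le_left (abs_nonneg x) this
  nlinarith [abs_nonneg x]

/-- Since `D` has mean zero, the character may be replaced by the character minus 1, which is of
size `|ξx|^ε`. -/
theorem norm_fourier_le_rpow_of_integral_eq_zero {D : ℝ → E} (hD : Integrable D)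
    (h0 : ∫ ξ, D ξ = 0) {ε : ℝ} (hε : 0 < ε) (hε1 : ε ≤ 1)
    (hDε : Integrable fun ξ => |ξ| ^ ε * ‖D ξ‖) (x : ℝ) :
    ‖𝓕 D x‖ ≤ 2 * (2 * Real.pi) ^ ε * (∫ ξ, |ξ| ^ ε * ‖D ξ‖) * |x| ^ ε := by
  have h1 : 𝓕 D x = ∫ ξ, ((𝐞 (-(ξ * x)) : ℂ) - 1) • D ξ := by
    simp only [sub_smul, one_smul]
    rw [integral_sub _ hD, h0, sub_zero, Real.fourier_real_eq]
    · rfl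
    · have := (Real.fourierIntegral_convergent_iff (μ := volume) (f := D) x).mpr hD
      refine this.congr (Eventually.of_forall fun ξ => ?_)
      simp [Circle.smul_def, mul_comm]
  rw [h1, mul_right_comm, ← integral_const_mul]
  refine norm_integral_le_of_norm_le (hDε.const_mul _) (Eventually.of_forall fun ξ => ?_)
  rw [norm_smul]
  calc ‖(𝐞 (-(ξ * x)) : ℂ) - 1‖ * ‖D ξ‖ ≤ (2 * (2 * Real.pi * |-(ξ * x)|) ^ ε) * ‖D ξ‖ := by
        gcongr
        exact norm_fourierChar_sub_one_le hε hε1 _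
    _ = _ := by
        rw [abs_neg, abs_mul, Real.mul_rpow Real.two_pi_pos.le (by positivity),
          Real.mul_rpow (abs_nonneg ξ) (abs_nonneg x)]
        ring

variable [CompleteSpace E]

/-- Integrability is asked only of derivatives of `H`. The kernel is the inverse transform of `H'`
divided by `-2πix`; near 0 it is `O(|x|^(ε-1))`, because `H'` has mean zero. -/
theorem exists_integrable_fourier_eq {H : ℝ → E} (hH : ContDiff ℝ 3 H)
    (h0 : Tendsto H (cocompact ℝ) (𝓝 0)) (h1 : Integrable (deriv H))
    (h2 : Integrable (deriv (deriv H))) (h3 : Integrable (deriv (deriv (deriv H))))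
    {ε : ℝ} (hε : 0 < ε) (hε1 : ε ≤ 1) (hHε : Integrable fun ξ => |ξ| ^ ε * ‖deriv H ξ‖) :
    ∃ G : ℝ → E, Integrable G ∧ 𝓕 G = H := by
  set D := deriv H
  have hD : ContDiff ℝ 2 D := by
    have := hH.iterate_deriv' 2 1
    simpa using this
  have hdH : Differentiable ℝ H := hH.differentiable (by norm_num)
  have hint : ∫ ξ, D ξ = 0 := by
    have := integral_of_hasDerivAt_of_tendsto (fun x => (hdH x).hasDerivAt) h1
      (h0.mono_left atBot_le_cocompact) (h0.mono_left atTop_le_cocompact)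
    simpa using this
  obtain ⟨C₀, hC₀⟩ : ∃ C, ∀ x, ‖𝓕 D x‖ ≤ C :=
    ⟨_, VectorFourier.norm_fourierIntegral_le_integral_norm 𝐞 volume (innerₗ ℝ) D⟩
  obtain ⟨C₁, hC₁0, hC₁⟩ : ∃ C, 0 ≤ C ∧ ∀ x, ‖𝓕 D x‖ ≤ C * |x| ^ ε :=
    ⟨_, by positivity, norm_fourier_le_rpow_of_integral_eq_zero h1 hint hε hε1 hHε⟩
  obtain ⟨C₂, hC₂⟩ : ∃ C, ∀ x, x ^ 2 * ‖𝓕 D x‖ ≤ C :=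
    ⟨_, sq_mul_norm_fourier_le hD h1 h2 h3⟩
  have hdecay : ∀ x, ‖𝓕 D x‖ ≤ (C₀ + C₂) * (1 + x ^ 2)⁻¹ := fun x => by
    rw [← div_eq_mul_inv, le_div_iff₀ (by positivity)]
    linarith [hC₀ x, hC₂ x]
  have hcont : Continuous (𝓕 D) :=
    VectorFourier.fourierIntegral_continuous Real.continuous_fourierChar continuous_inner h1
  have hFint : Integrable (𝓕 D) :=
    (integrable_inv_one_add_sq.const_mul (C₀ + C₂)).mono' hcont.aestronglyMeasurable
      (Eventually.of_forall hdecay)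
  have hinv : 𝓕 (𝓕⁻ D) = D := hD.continuous.fourier_fourierInv_eq h1 hFint
  set g := 𝓕⁻ D
  have hgF : ∀ x, g x = 𝓕 D (-x) := fun x => Real.fourierInv_eq_fourier_neg D x
  have hgint : Integrable g := by
    rw [show g = fun x => 𝓕 D (-x) from funext hgF]
    exact hFint.comp_neg
  have hgcont : Continuous g := by
    rw [show g = fun x => 𝓕 D (-x) from funext hgF]
    exact hcont.comp continuous_neg
  -- Differentiating a Fourier transform multiplies the function by `-2πix`, so this choice forces
  -- `(𝓕 G)' = 𝓕 g = H'`.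
  let G : ℝ → E := fun x => (-2 * Real.pi * Complex.I * x : ℂ)⁻¹ • g x
  have hGm : AEStronglyMeasurable G volume := by
    refine AEStronglyMeasurable.smul ?_ hgcont.aestronglyMeasurable
    exact (Measurable.inv (by fun_prop)).aestronglyMeasurable
  have hGnorm : ∀ x, ‖G x‖ ≤ |x|⁻¹ * ‖g x‖ := fun x => by
    simp only [G]
    rw [norm_smul, norm_inv]
    simp only [norm_mul, norm_neg, Complex.norm_ofNat, Complex.norm_real, Complex.norm_I,
      Real.norm_eq_abs, abs_of_pos Real.pi_pos, mul_one, mul_inv]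
    have : (2:ℝ)⁻¹ * Real.pi⁻¹ ≤ 1 := by
      rw [← mul_inv]
      exact inv_le_one_of_one_le₀ (by linarith [Real.pi_gt_three])
    have h6 : 0 ≤ |x|⁻¹ * ‖g x‖ := by positivity
    nlinarith
  have hGint : Integrable G := by
    have hb1 : Integrable (indicator (Ioc (-1) 1) fun x : ℝ => C₁ * |x| ^ (ε - 1)) := by
      rw [integrable_indicator_iff measurableSet_Ioc,
        ← intervalIntegrable_iff_integrableOn_Ioc_of_le (by norm_num)]
      exact (intervalIntegrable_abs_rpow (by linarith) _ _).const_mul C₁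
    refine (hb1.add hgint.norm).mono' hGm (Eventually.of_forall fun x => (hGnorm x).trans ?_)
    simp only [Pi.add_apply]
    by_cases hx : x ∈ Ioc (-1 : ℝ) 1
    · rw [indicator_of_mem hx]
      refine le_add_of_le_of_nonneg ?_ (norm_nonneg _)
      rcases eq_or_ne x 0 with rfl | hx0
      · simp only [abs_zero, inv_zero, zero_mul]
        positivity
      · have h7 : ‖g x‖ ≤ C₁ * |x| ^ ε := by
          rw [hgF]
          simpa using hC₁ (-x)
        rw [Real.rpow_sub_one (abs_ne_zero.mpr hx0)]
        calc |x|⁻¹ * ‖g x‖ ≤ |x|⁻¹ * (C₁ * |x| ^ ε) := by gcongr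
          _ = _ := by ring
    · rw [indicator_of_notMem hx, zero_add]
      refine mul_le_of_le_one_left (norm_nonneg _) (inv_le_one_of_one_le₀ ?_)
      by_contra! h
      exact hx ⟨(abs_lt.mp h).1, (abs_lt.mp h).2.le⟩
  have hne : ∀ᵐ x : ℝ, x ≠ 0 := by simp [ae_iff]
  have hxG : (fun x : ℝ => (-2 * Real.pi * Complex.I * x : ℂ) • G x) =ᵐ[volume] g := by
    filter_upwards [hne] with x hx
    refine smul_inv_smul₀ ?_ _
    simp [Real.pi_ne_zero, hx]
  have hxG' : Integrable fun x : ℝ => x • G x := by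
    refine ((hgint.congr hxG.symm).smul (-2 * Real.pi * Complex.I : ℂ)⁻¹).congr
      (Eventually.of_forall fun x => ?_)
    simp only [Pi.smul_apply, smul_smul]
    rw [← mul_assoc, inv_mul_cancel₀ (by simp [Real.pi_ne_zero]), one_mul, Complex.coe_smul]
  refine ⟨G, hGint, ?_⟩
  have hderiv : ∀ w, HasDerivAt (𝓕 G) (D w) w := fun w => by
    have := Real.hasDerivAt_fourier hGint hxG' w
    rwa [Real.fourier_congr_ae hxG, hinv] at this
  -- The constant is zero: `𝓕 G` vanishes at infinity by Riemann–Lebesgue, and `H` by hypothesis.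
  have hconst : ∀ x y, (𝓕 G - H) x = (𝓕 G - H) y := by
    refine is_const_of_deriv_eq_zero (fun w => ((hderiv w).sub (hdH w).hasDerivAt).differentiableAt)
      fun w => ?_
    rw [((hderiv w).sub (hdH w).hasDerivAt).deriv, sub_self]
  have hlim : Tendsto (𝓕 G - H) (cocompact ℝ) (𝓝 0) := by
    have := (Real.zero_at_infty_fourier G).sub h0
    rwa [sub_zero] at this
  ext x
  have h8 : Tendsto (𝓕 G - H) (cocompact ℝ) (𝓝 ((𝓕 G - H) x)) :=
    tendsto_const_nhds.congr fun y => hconst x y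
  exact sub_eq_zero.mp (tendsto_nhds_unique h8 hlim)

end SymbolToKernel

/-! ### Beurling spectrum and local vanishing -/

section Beurling

theorem fourierL1_two_pi_mul (f : ℝ → ℂ) (ξ : ℝ) :
    fourierL1 f (2 * Real.pi * ξ) = 𝓕 f ξ := by
  rw [Real.fourier_real_eq_integral_exp_smul]
  refine integral_congr_ae (Eventually.of_forall fun t => ?_)
  simp only [smul_eq_mul]
  rw [mul_comm]
  congr 2
  push_cast
  ring

theorem exists_schwartz_fourier_eq_one : ∃ τ : 𝓢(ℝ, ℂ), ∀ ξ : ℝ, |ξ| ≤ 1 → 𝓕 (τ : ℝ → ℂ) ξ = 1 := by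
  let b : ContDiffBump (0 : ℝ) := ⟨1, 2, one_pos, one_lt_two⟩
  have hg₁ : HasCompactSupport (Complex.ofRealCLM ∘ b) := b.hasCompactSupport.comp_left rfl
  have hg₂ : ContDiff ℝ (⊤ : ℕ∞) (Complex.ofRealCLM ∘ b) :=
    Complex.ofRealCLM.contDiff.comp b.contDiff
  refine ⟨𝓕⁻ (hg₁.toSchwartzMap hg₂), fun ξ hξ => ?_⟩
  rw [← SchwartzMap.fourier_coe, FourierTransform.fourier_fourierInv_eq]
  have : b ξ = 1 := b.one_of_mem_closedBall (by simpa using hξ)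
  simp [this]

/-- The function `t ↦ ε τ(ε t) e^{2πi ξ₀ t}`, whose Fourier transform is `ξ ↦ τ̂((ξ - ξ₀) / ε)`. -/
noncomputable def modulatedDilation (τ : ℝ → ℂ) (ξ₀ ε : ℝ) : ℝ → ℂ :=
  fun t => ε * τ (ε * t) * 𝐞 (ξ₀ * t)

theorem integrable_modulatedDilation {τ : ℝ → ℂ} (hτ : Integrable τ) (ξ₀ : ℝ) {ε : ℝ}
    (hε : 0 < ε) : Integrable (modulatedDilation τ ξ₀ ε) := by
  have h1 : Integrable fun t => (ε : ℂ) * τ (ε * t) := (hτ.comp_mul_left' hε.ne').const_mul _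
  have hc : Continuous fun t : ℝ => (𝐞 (ξ₀ * t) : ℂ) := by fun_prop
  refine h1.mono (h1.1.mul hc.aestronglyMeasurable) (Eventually.of_forall fun t => ?_)
  rw [modulatedDilation, norm_mul _ (𝐞 (ξ₀ * t) : ℂ), Circle.norm_coe, mul_one]

theorem fourier_modulatedDilation (τ : ℝ → ℂ) (ξ₀ : ℝ) {ε : ℝ} (hε : 0 < ε) (ξ : ℝ) :
    𝓕 (modulatedDilation τ ξ₀ ε) ξ = 𝓕 τ ((ξ - ξ₀) / ε) := by
  rw [Real.fourier_real_eq, Real.fourier_real_eq]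
  have h := Measure.integral_comp_mul_left
    (fun s => (𝐞 (-(s * ((ξ - ξ₀) / ε))) : ℂ) * τ s) ε
  have h2 : ∀ t, 𝐞 (-(t * ξ)) • modulatedDilation τ ξ₀ ε t
      = (ε : ℂ) * ((𝐞 (-(ε * t * ((ξ - ξ₀) / ε))) : ℂ) * τ (ε * t)) := fun t => by
    have h3 : -(ε * t * ((ξ - ξ₀) / ε)) = -(t * ξ) + ξ₀ * t := by
      field_simp
      ring
    rw [h3, AddChar.map_add_eq_mul, Circle.smul_def, modulatedDilation, Circle.coe_mul, smul_eq_mul]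
    ring
  simp only [h2]
  rw [integral_const_mul, h, abs_of_pos (inv_pos.mpr hε), Complex.real_smul, ← mul_assoc,
    ← Complex.ofReal_mul, mul_inv_cancel₀ hε.ne', Complex.ofReal_one, one_mul]
  rfl

/-- Up to the phase `𝐞 (ξ₀ h)`, a kernel concentrated in frequency within `ε` of `ξ₀` is nearly
invariant under shifts `h` much smaller than `1/ε`. -/
theorem integral_norm_translate_modulatedDilation (τ : ℝ → ℂ) (ξ₀ : ℝ) {ε : ℝ} (hε : 0 < ε)
    (h : ℝ) :
    ∫ r, ‖modulatedDilation τ ξ₀ ε (h + r) - 𝐞 (ξ₀ * h) * modulatedDilation τ ξ₀ ε r‖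
      = ∫ r, ‖τ (ε * h + r) - τ r‖ := by
  have h1 := Measure.integral_comp_mul_left (fun r => ‖τ (ε * h + r) - τ r‖) ε
  have h2 : ∀ r, ‖modulatedDilation τ ξ₀ ε (h + r) - 𝐞 (ξ₀ * h) * modulatedDilation τ ξ₀ ε r‖
      = ε * ‖τ (ε * h + ε * r) - τ (ε * r)‖ := fun r => by
    have : modulatedDilation τ ξ₀ ε (h + r) - 𝐞 (ξ₀ * h) * modulatedDilation τ ξ₀ ε r
        = ε * (τ (ε * h + ε * r) - τ (ε * r)) * (𝐞 (ξ₀ * h) * 𝐞 (ξ₀ * r)) := by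
      simp only [modulatedDilation]
      rw [mul_add ξ₀, AddChar.map_add_eq_mul, Circle.coe_mul, mul_add ε]
      ring
    rw [this, norm_mul, norm_mul, norm_mul, Circle.norm_coe, Circle.norm_coe, Complex.norm_real,
      Real.norm_of_nonneg hε.le, mul_one, mul_one]
  simp only [h2]
  rw [integral_const_mul, h1, abs_of_pos (inv_pos.mpr hε), smul_eq_mul, ← mul_assoc,
    mul_inv_cancel₀ hε.ne', one_mul]

theorem integral_norm_translate_sub_le {τ : ℝ → ℂ} (hτ : Integrable τ) (h : ℝ) :
    ∫ r, ‖τ (h + r) - τ r‖ ≤ 2 * ∫ r, ‖τ r‖ := by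
  calc ∫ r, ‖τ (h + r) - τ r‖ ≤ ∫ r, (‖τ (h + r)‖ + ‖τ r‖) :=
        integral_mono ((hτ.comp_add_left h).sub hτ).norm
          ((hτ.comp_add_left h).norm.add hτ.norm) fun r => norm_sub_le _ _
    _ = _ := by
        rw [integral_add (hτ.comp_add_left h).norm hτ.norm,
          integral_add_left_eq_self (fun r => ‖τ r‖) h]
        ring

theorem integrable_norm_mul_translate {f τ : ℝ → ℂ} (hf : Integrable f) (hτ : Integrable τ)
    (ε : ℝ) : Integrable fun s => ‖f s‖ * ∫ r, ‖τ (ε * -s + r) - τ r‖ := by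
  refine (hf.norm.mul_const (2 * ∫ r, ‖τ r‖)).mono' (hf.norm.1.mul
    ((continuous_integral_norm_translate_sub hτ).comp
      (by fun_prop : Continuous fun s : ℝ => ε * -s)).aestronglyMeasurable)
    (Eventually.of_forall fun s => ?_)
  rw [norm_mul, norm_norm, Real.norm_of_nonneg (by positivity)]
  gcongr
  exact integral_norm_translate_sub_le hτ _

theorem tendsto_integral_mul_translate {f τ : ℝ → ℂ} (hf : Integrable f) (hτ : Integrable τ) :
    Tendsto (fun ε : ℝ => ∫ s, ‖f s‖ * ∫ r, ‖τ (ε * -s + r) - τ r‖) (𝓝 0) (𝓝 0) := by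
  have hN := continuous_integral_norm_translate_sub hτ
  have h0 : (0 : ℝ) = ∫ s, ‖f s‖ * ∫ r, ‖τ (0 * -s + r) - τ r‖ := by simp
  nth_rewrite 2 [h0]
  refine tendsto_integral_filter_of_dominated_convergence (fun s => ‖f s‖ * (2 * ∫ r, ‖τ r‖))
    ?_ ?_ (hf.norm.mul_const _) ?_
  · refine Eventually.of_forall fun ε => hf.norm.1.mul ?_
    exact (hN.comp (by fun_prop : Continuous fun s : ℝ => ε * -s)).aestronglyMeasurable
  · refine Eventually.of_forall fun ε => Eventually.of_forall fun s => ?_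
    rw [norm_mul, norm_norm, Real.norm_of_nonneg (by positivity)]
    gcongr
    exact integral_norm_translate_sub_le hτ _
  · refine Eventually.of_forall fun s => ?_
    refine Tendsto.const_mul _ ?_
    exact ((hN.comp (by fun_prop : Continuous fun ε : ℝ => ε * -s)).tendsto 0)

variable {X : Type*} [NormedAddCommGroup X] [NormedSpace ℂ X]

theorem integrable_smul_one {f : ℝ → ℂ} (hf : Integrable f) :
    Integrable fun s => f s • (1 : X →L[ℂ] X) := hf.smul_const _

theorem opConv_zero (G : ℝ → X →L[ℂ] X) : opConv G 0 = 0 := by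
  ext t
  simp [opConv_apply]

theorem integral_norm_smul_one_le {f : ℝ → ℂ} (hf : Integrable f) :
    ∫ s, ‖f s • (1 : X →L[ℂ] X)‖ ≤ ∫ s, ‖f s‖ := by
  refine integral_mono (integrable_smul_one hf).norm hf.norm fun s => ?_
  simp only [norm_smul]
  exact mul_le_of_le_one_right (norm_nonneg _) ContinuousLinearMap.norm_id_le

theorem norm_scalarConv_le {f : ℝ → ℂ} {φ : ℝ → X} (hf : Integrable f) (hφ : MemLp φ ⊤ volume)
    (t : ℝ) : ‖scalarConv f φ t‖ ≤ (∫ s, ‖f s‖) * (eLpNorm φ ⊤ volume).toReal := by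
  refine (norm_opConv_le (integrable_smul_one hf) hφ t).trans ?_
  exact mul_le_mul_of_nonneg_right (integral_norm_smul_one_le hf) ENNReal.toReal_nonneg

theorem scalarConv_fourierInv_sum {ι : Type*} (s : Finset ι) (k : ι → 𝓢(ℝ, ℂ)) {φ : ℝ → X}
    (hφ : MemLp φ ⊤ volume) (h : ∀ i ∈ s, scalarConv (𝓕⁻ (k i) : 𝓢(ℝ, ℂ)) φ = 0) :
    scalarConv (𝓕⁻ (∑ i ∈ s, k i) : 𝓢(ℝ, ℂ)) φ = 0 := by
  classical
  rw [FourierTransform.fourierInv_sum]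
  induction s using Finset.induction_on with
  | empty =>
    ext t
    simp [scalarConv_eq_opConv, opConv_apply]
  | insert i s hi ih =>
    ext t
    have h1 := congrFun (h i (Finset.mem_insert_self i s)) t
    have h2 := congrFun (ih fun j hj => h j (Finset.mem_insert_of_mem hj)) t
    rw [Finset.sum_insert hi]
    have h3 := opConv_add (integrable_smul_one (X := X) (𝓕⁻ (k i) : 𝓢(ℝ, ℂ)).integrable)
      (integrable_smul_one (X := X) (∑ j ∈ s, 𝓕⁻ (k j) : 𝓢(ℝ, ℂ)).integrable) hφ t
    rw [← scalarConv_eq_opConv, ← scalarConv_eq_opConv, h1, h2] at h3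
    rw [scalarConv_eq_opConv]
    refine Eq.trans (opConv_congr_ae (Eventually.of_forall fun r => ?_) φ t) (h3.trans (add_zero 0))
    simp [add_smul]

variable [CompleteSpace X]

theorem scalarConv_opConv_comm {f : ℝ → ℂ} {G : ℝ → X →L[ℂ] X} {φ : ℝ → X} (hf : Integrable f)
    (hG : Integrable G) (hφ : MemLp φ ⊤ volume) :
    scalarConv f (opConv G φ) = opConv G (scalarConv f φ) := by
  ext t
  simp only [scalarConv_eq_opConv]
  refine opConv_comm (integrable_smul_one (X := X) hf) hG (fun ξ => ?_) hφ t
  rw [fourier_smul_const, Commute, SemiconjBy, smul_mul_assoc, mul_smul_comm, one_mul, mul_one]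

/-- Scalar kernels commute with `G`, so every `f` annihilating `φ` annihilates `G * φ`. -/
theorem beurlingSpectrum_opConv_subset {G : ℝ → X →L[ℂ] X} {φ : ℝ → X}
    (hG : Integrable G) (hφ : MemLp φ ⊤ volume) :
    beurlingSpectrum (opConv G φ) ⊆ beurlingSpectrum φ := fun ω hω f hf hfφ =>
  hω f hf (by rw [scalarConv_opConv_comm hf hG hφ, hfφ, opConv_zero])

/-- Reproduced by a kernel concentrated near `ξ₀`, `v` behaves like a pure wave of frequency `ξ₀`,
so `f * v` is close to `𝓕 f ξ₀ • v`. As `f * v = 0`, the norm of `v` is at most a factor below 1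
times itself. -/
theorem eq_zero_of_bernstein {f τ : ℝ → ℂ} {v : ℝ → X} {ξ₀ ε : ℝ} (hf : Integrable f)
    (hτ : Integrable τ) (hε : 0 < ε) (hv : MemLp v ⊤ volume) (hfv : scalarConv f v = 0)
    (hτv : scalarConv (modulatedDilation τ ξ₀ ε) v = v)
    (hlt : ∫ s, ‖f s‖ * (∫ r, ‖τ (ε * -s + r) - τ r‖) < ‖𝓕 f ξ₀‖) : v = 0 := by
  set C := (eLpNorm v ⊤ volume).toReal
  set δ := ∫ s, ‖f s‖ * (∫ r, ‖τ (ε * -s + r) - τ r‖)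
  have hm := integrable_modulatedDilation hτ ξ₀ hε
  have hshift : ∀ t s, ‖v (-s + t) - (𝐞 (ξ₀ * -s) : ℂ) • v t‖
      ≤ (∫ r, ‖τ (ε * -s + r) - τ r‖) * C := fun t s => by
    have h1 : v (-s + t) - (𝐞 (ξ₀ * -s) : ℂ) • v t = scalarConv (fun r =>
        modulatedDilation τ ξ₀ ε (-s + r) - 𝐞 (ξ₀ * -s) * modulatedDilation τ ξ₀ ε r) v t := by
      conv_lhs => rw [← hτv]
      have e1 := opConv_sub (integrable_smul_one (X := X) (hm.comp_add_left (-s)))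
        ((integrable_smul_one (X := X) hm).smul (𝐞 (ξ₀ * -s) : ℂ)) hv t
      rw [opConv_const_smul, ← scalarConv_eq_opConv] at e1
      simp only [scalarConv_eq_opConv]
      rw [← opConv_translate]
      refine e1.symm.trans (opConv_congr_ae (Eventually.of_forall fun r => ?_) v t)
      simp [sub_smul, mul_smul]
    rw [h1, ← integral_norm_translate_modulatedDilation τ ξ₀ hε]
    exact norm_scalarConv_le ((hm.comp_add_left (-s)).sub (hm.const_mul _)) hv t
  have hδ0 : 0 ≤ δ := by positivity
  have hpos : 0 < ‖𝓕 f ξ₀‖ := hδ0.trans_lt hlt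
  have hNint := (integrable_norm_mul_translate hf hτ ε).mul_const C
  have hbound : ∀ t, ‖𝓕 f ξ₀‖ * ‖v t‖ ≤ δ * C := fun t => by
    have e0 : ∫ s, f s • v (t - s) = 0 := congrFun hfv t
    have i0 : Integrable fun s => f s • v (t - s) :=
      integrable_opConv_integrand (integrable_smul_one hf) hv t
    have i1 : Integrable fun s => (𝐞 (-(s * ξ₀)) • f s) • v t := by
      refine Integrable.smul_const ?_ (v t)
      have := (Real.fourierIntegral_convergent_iff (μ := volume) (f := f) ξ₀).mpr hf
      refine this.congr (Eventually.of_forall fun s => ?_)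
      simp [mul_comm]
    have e1 : 𝓕 f ξ₀ • v t = ∫ s, ((𝐞 (-(s * ξ₀)) • f s) • v t - f s • v (t - s)) := by
      rw [integral_sub i1 i0, e0, sub_zero, integral_smul_const, Real.fourier_real_eq]
    rw [← norm_smul, e1, ← integral_mul_const]
    refine norm_integral_le_of_norm_le hNint (Eventually.of_forall fun s => ?_)
    have e2 : (𝐞 (-(s * ξ₀)) • f s) • v t - f s • v (t - s)
        = -(f s • (v (-s + t) - (𝐞 (ξ₀ * -s) : ℂ) • v t)) := by
      rw [smul_sub, neg_sub, smul_smul, Circle.smul_def, smul_eq_mul, mul_comm (f s),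
        neg_add_eq_sub, mul_neg, mul_comm s]
    rw [e2, norm_neg, norm_smul, mul_assoc]
    gcongr
    exact hshift t s
  -- The pointwise bound passes to the essential supremum `C`, giving `‖𝓕 f ξ₀‖ * C ≤ δ * C` with `δ
  -- < ‖𝓕 f ξ₀‖`.
  have hC0 : C = 0 := by
    have h1 : eLpNorm v ⊤ volume ≤ ENNReal.ofReal (δ * C / ‖𝓕 f ξ₀‖) := by
      refine eLpNormEssSup_le_of_ae_bound (Eventually.of_forall fun t => ?_)
      rw [le_div_iff₀ hpos, mul_comm]
      exact hbound t
    have h2 : C ≤ δ * C / ‖𝓕 f ξ₀‖ := ENNReal.toReal_le_of_le_ofReal (by positivity) h1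
    rw [le_div_iff₀ hpos] at h2
    have hC : 0 ≤ C := ENNReal.toReal_nonneg
    nlinarith
  ext t
  have := hbound t
  rw [hC0, mul_zero] at this
  have h3 : ‖v t‖ ≤ 0 := by
    by_contra! h
    have := mul_pos hpos h
    linarith
  exact norm_le_zero_iff.mp h3

/-- The Bernstein lemma applies to `v = 𝓕⁻ k * φ`: `f` annihilates it, and the dilated `τ`, whose
transform is 1 on the ball containing `supp k`, reproduces it. -/
theorem exists_nhds_scalarConv_fourierInv_eq_zero {φ : ℝ → X} (hφ : MemLp φ ⊤ volume) {f : ℝ → ℂ}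
    (hf : Integrable f) (hfφ : scalarConv f φ = 0) {ξ₀ : ℝ} (hξ₀ : 𝓕 f ξ₀ ≠ 0) :
    ∃ U : Set ℝ, IsOpen U ∧ ξ₀ ∈ U ∧ ∀ k : 𝓢(ℝ, ℂ), tsupport k ⊆ U →
      scalarConv (𝓕⁻ k : 𝓢(ℝ, ℂ)) φ = 0 := by
  obtain ⟨τ, hτ1⟩ := exists_schwartz_fourier_eq_one
  have hlim := (tendsto_integral_mul_translate hf τ.integrable).eventually_lt_const
    (norm_pos_iff.mpr hξ₀)
  obtain ⟨ε, hlt, hε : 0 < ε⟩ := ((hlim.filter_mono nhdsWithin_le_nhds).and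
    (self_mem_nhdsWithin (s := Ioi (0 : ℝ)))).exists
  refine ⟨Metric.ball ξ₀ ε, Metric.isOpen_ball, Metric.mem_ball_self hε, fun k hk => ?_⟩
  have hki : Integrable (𝓕⁻ k : 𝓢(ℝ, ℂ)) := SchwartzMap.integrable _
  have hkF : 𝓕 ((𝓕⁻ k : 𝓢(ℝ, ℂ)) : ℝ → ℂ) = k := by
    rw [← SchwartzMap.fourier_coe, FourierTransform.fourier_fourierInv_eq]
  have hm := integrable_modulatedDilation τ.integrable ξ₀ hε
  refine eq_zero_of_bernstein hf τ.integrable hε (memLp_opConv (integrable_smul_one hki) hφ)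
    ?_ ?_ hlt
  · rw [scalarConv_eq_opConv (⇑(𝓕⁻ k : 𝓢(ℝ, ℂ))),
      scalarConv_opConv_comm hf (integrable_smul_one hki) hφ, hfφ, opConv_zero]
  · ext t
    rw [scalarConv_eq_opConv, scalarConv_eq_opConv,
      ← opConv_convolution (integrable_smul_one hm) (integrable_smul_one hki) hφ]
    refine opConv_eq_of_fourier_eq ((integrable_smul_one hm).integrable_convolution _
      (integrable_smul_one hki)) (integrable_smul_one hki) (fun ξ => ?_) φ t
    rw [fourier_mul_convolution (integrable_smul_one hm) (integrable_smul_one hki),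
      fourier_smul_const, fourier_smul_const, fourier_modulatedDilation _ _ hε, hkF]
    by_cases hξ : ξ ∈ Metric.ball ξ₀ ε
    · rw [hτ1, one_smul, one_mul]
      rw [abs_div, abs_of_pos hε, div_le_one hε]
      exact (Metric.mem_ball.mp hξ).le
    · have : k ξ = 0 := image_eq_zero_of_notMem_tsupport fun h => hξ (hk h)
      simp [this]

/-- Each frequency of `supp k` has a neighbourhood of vanishing; compactness and a smooth partition
of unity split `k` into pieces living in finitely many of them. -/
theorem scalarConv_fourierInv_eq_zero {φ : ℝ → X} (hφ : MemLp φ ⊤ volume) (k : 𝓢(ℝ, ℂ))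
    (hk : HasCompactSupport k)
    (hdisj : ∀ ξ ∈ tsupport k, 2 * Real.pi * ξ ∉ beurlingSpectrum φ) :
    scalarConv (𝓕⁻ k : 𝓢(ℝ, ℂ)) φ = 0 := by
  have hloc : ∀ ξ : tsupport k, ∃ U : Set ℝ, IsOpen U ∧ (ξ : ℝ) ∈ U ∧ ∀ l : 𝓢(ℝ, ℂ),
      tsupport l ⊆ U → scalarConv (𝓕⁻ l : 𝓢(ℝ, ℂ)) φ = 0 := fun ξ => by
    have := hdisj ξ ξ.2
    simp only [beurlingSpectrum, mem_ofPred_eq, not_forall] at this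
    obtain ⟨f, hf, hfφ, hne⟩ := this
    rw [fourierL1_two_pi_mul] at hne
    exact exists_nhds_scalarConv_fourierInv_eq_zero hφ hf hfφ hne
  choose U hUo hUm hU using hloc
  obtain ⟨t, ht⟩ := hk.elim_finite_subcover U hUo
    fun ξ hξ => mem_iUnion_of_mem ⟨ξ, hξ⟩ (hUm ⟨ξ, hξ⟩)
  obtain ⟨ρ, hρ⟩ := SmoothPartitionOfUnity.exists_isSubordinate (modelWithCornersSelf ℝ ℝ)
    (isClosed_tsupport k) (fun i : t => U i) (fun i => hUo i)
    (by simpa [iUnion_subtype] using ht)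
  have hc : ∀ i : t, HasCompactSupport fun x => (ρ i x : ℂ) * k x := fun i => hk.mul_left
  have hd : ∀ i : t, ContDiff ℝ (⊤ : ℕ∞) fun x => (ρ i x : ℂ) * k x := fun i =>
    (Complex.ofRealCLM.contDiff.comp (ρ i).contMDiff.contDiff).mul (k.smooth _)
  have hsum : k = ∑ i : t, (hc i).toSchwartzMap (hd i) := by
    ext x
    rw [sum_apply]
    change k x = ∑ i : t, (ρ i x : ℂ) * k x
    rw [← Finset.sum_mul, ← Complex.ofReal_sum]
    by_cases hx : x ∈ tsupport k
    · have := ρ.sum_eq_one hx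
      rw [finsum_eq_sum_of_fintype] at this
      rw [this, Complex.ofReal_one, one_mul]
    · simp [image_eq_zero_of_notMem_tsupport hx]
  rw [hsum]
  refine scalarConv_fourierInv_sum _ _ hφ fun i _ => hU i _ ?_
  refine Subset.trans ?_ (hρ i)
  refine closure_mono fun x hx => ?_
  rw [Function.mem_support] at hx ⊢
  intro h0
  apply hx
  change (ρ i x : ℂ) * k x = 0
  rw [h0, Complex.ofReal_zero, zero_mul]

end Beurling

/-! ### Integrability from power decay -/

section Decay

theorem integrable_of_norm_le_rpow {E : Type*} [NormedAddCommGroup E] {f : ℝ → E}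
    (hf : Continuous f) {b C s : ℝ} (hb : 1 ≤ b) (hs : 1 < s)
    (h : ∀ ξ, b < |ξ| → ‖f ξ‖ ≤ C * |ξ| ^ (-s)) : Integrable f := by
  have hg : Integrable fun x : ℝ => (1 + ‖x‖) ^ (-s) := integrable_one_add_norm (by simpa using hs)
  refine hf.locallyIntegrable.integrable_of_isBigO_cocompact (g := fun x : ℝ => (1 + ‖x‖) ^ (-s))
    ?_ (hg.integrableAtFilter _)
  -- The factor `2 ^ s` comes from `1 + |ξ| ≤ 2|ξ|`, valid since `|ξ| > b ≥ 1`.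
  refine Asymptotics.IsBigO.of_bound (|C| * 2 ^ s) ?_
  filter_upwards [tendsto_norm_cocompact_atTop.eventually_gt_atTop b] with ξ hξ
  rw [Real.norm_eq_abs] at hξ
  have hξ0 : 0 < |ξ| := by linarith
  refine (h ξ hξ).trans ?_
  rw [Real.norm_of_nonneg (by positivity), Real.norm_eq_abs, mul_assoc]
  have h1 : |ξ| ^ (-s) ≤ 2 ^ s * (1 + |ξ|) ^ (-s) := by
    rw [Real.rpow_neg (by positivity), Real.rpow_neg (by positivity), ← div_eq_mul_inv,
      ← Real.div_rpow (by positivity) (by positivity), ← Real.inv_rpow (by positivity)]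
    refine Real.rpow_le_rpow (by positivity) ?_ (by linarith)
    rw [inv_eq_one_div, div_le_div_iff₀ hξ0 (by positivity)]
    linarith
  calc C * |ξ| ^ (-s) ≤ |C| * |ξ| ^ (-s) := by gcongr; exact le_abs_self C
    _ ≤ _ := by gcongr

end Decay

/-! ### The resolvent: identities, smoothness, and the kernel `G` -/

namespace UnboundedOp

variable {X : Type*} [NormedAddCommGroup X] [NormedSpace ℂ X]

theorem IsResolvent.eq_add {A : X →ₗ.[ℂ] X} {z w : ℂ} {R S : X →L[ℂ] X}
    (hR : IsResolvent A z R) (hS : IsResolvent A w S) : R = S + (w - z) • (S * R) := by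
  ext x
  obtain ⟨h, hx⟩ := hR.1 x
  have h2 := hS.2 ⟨R x, h⟩
  have h3 : w • R x - A ⟨R x, h⟩ = x + (w - z) • R x := by
    rw [← sub_eq_iff_eq_add'.mpr (sub_eq_iff_eq_add.mp hx)]
    module
  rw [h3, map_add, map_smul] at h2
  exact h2.symm

/-- From the factorisation `w - A = (1 + (w - z)R)(z - A)`. -/
theorem IsResolvent.mul_inverse {A : X →ₗ.[ℂ] X} {z w : ℂ} {R : X →L[ℂ] X}
    (hR : IsResolvent A z R) (hu : IsUnit (1 + (w - z) • R)) :
    IsResolvent A w (R * Ring.inverse (1 + (w - z) • R)) := by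
  set B := Ring.inverse (1 + (w - z) • R)
  have hB1 : (1 + (w - z) • R) * B = 1 := Ring.mul_inverse_cancel _ hu
  have hB2 : B * (1 + (w - z) • R) = 1 := Ring.inverse_mul_cancel _ hu
  refine ⟨fun x => ?_, fun y => ?_⟩
  · obtain ⟨h, hx⟩ := hR.1 (B x)
    refine ⟨h, ?_⟩
    have h1 : B x + (w - z) • R (B x) = x := congrArg (fun T : X →L[ℂ] X => T x) hB1
    change w • R (B x) - A ⟨R (B x), h⟩ = x
    generalize A ⟨R (B x), h⟩ = y at hx ⊢
    generalize R (B x) = v at hx h1 ⊢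
    rw [← h1, ← hx]
    module
  · have h1 := hR.2 y
    set q := z • (y : X) - A y
    have h2 : w • (y : X) - A y = q + (w - z) • R q := by
      rw [h1]
      simp only [q]
      module
    have h3 : B (q + (w - z) • R q) = q := congrArg (fun T : X →L[ℂ] X => T q) hB2
    rw [h2, mul_apply_eq_comp, h3, h1]

variable [CompleteSpace X]

theorem eventually_isResolvent {A : X →ₗ.[ℂ] X} {z : ℂ} (hz : z ∉ spec A) :
    ∀ᶠ w in 𝓝 z, w ∉ spec A ∧
      resolv A w = resolv A z * Ring.inverse (1 + (w - z) • resolv A z) := by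
  have hc : Continuous fun w : ℂ => 1 + (w - z) • resolv A z := by fun_prop
  have hu : ∀ᶠ w in 𝓝 z, IsUnit (1 + (w - z) • resolv A z) := by
    refine hc.continuousAt.eventually (Units.isOpen.mem_nhds ?_)
    simp
  filter_upwards [hu] with w hw
  have h := (isResolvent_resolv hz).mul_inverse hw
  have hw' : w ∉ spec A := not_not.mpr ⟨_, h⟩
  exact ⟨hw', (isResolvent_resolv hw').unique h⟩

theorem contDiffAt_resolv {A : X →ₗ.[ℂ] X} {z : ℂ} (hz : z ∉ spec A) (n : WithTop ℕ∞) :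
    ContDiffAt ℂ n (resolv A) z := by
  have h1 : ContDiffAt ℂ n (fun w : ℂ => 1 + (w - z) • resolv A z) z := by fun_prop
  have h2 : ContDiffAt ℂ n (Ring.inverse : (X →L[ℂ] X) → (X →L[ℂ] X))
      (1 + (z - z) • resolv A z) := by
    have := contDiffAt_ringInverse ℂ (n := n) (1 : (X →L[ℂ] X)ˣ)
    simpa using this
  have h3 : ContDiffAt ℂ n (fun w => resolv A z * Ring.inverse (1 + (w - z) • resolv A z)) z :=
    contDiffAt_const.mul (show ContDiffAt ℂ n
      (Ring.inverse ∘ fun w => 1 + (w - z) • resolv A z) z from h2.comp z h1)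
  refine h3.congr_of_eventuallyEq ?_
  filter_upwards [eventually_isResolvent hz] with w hw using hw.2

theorem hasDerivAt_resolv {A : X →ₗ.[ℂ] X} {z : ℂ} (hz : z ∉ spec A) :
    HasDerivAt (resolv A) (-(resolv A z ^ 2)) z := by
  rw [hasDerivAt_iff_tendsto_slope]
  have hc : ContinuousAt (resolv A) z := (contDiffAt_resolv hz 0).continuousAt
  have h1 : Tendsto (fun w => -(resolv A w * resolv A z)) (𝓝[≠] z) (𝓝 (-(resolv A z ^ 2))) := by
    rw [pow_two]
    exact ((hc.mul continuousAt_const).neg.tendsto).mono_left nhdsWithin_le_nhds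
  refine h1.congr' ?_
  filter_upwards [nhdsWithin_le_nhds (eventually_isResolvent hz), self_mem_nhdsWithin] with w hw hne
  have h2 := (isResolvent_resolv hz).eq_add (isResolvent_resolv hw.1)
  have h3 : resolv A w - resolv A z = -((w - z) • (resolv A w * resolv A z)) := by
    rw [sub_eq_iff_eq_add, neg_add_eq_sub, eq_sub_iff_add_eq]
    exact h2.symm
  rw [slope_def_module, h3, smul_neg, smul_smul, inv_mul_cancel₀ (sub_ne_zero.mpr hne), one_smul]

/-- The resolvent on the imaginary axis in the frequency variable `ξ = ω / 2π`. -/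
noncomputable def freqResolv (A : X →ₗ.[ℂ] X) (ξ : ℝ) : X →L[ℂ] X :=
  resolv A (Complex.I * ((2 * Real.pi * ξ : ℝ) : ℂ))

theorem contDiffAt_freqResolv {A : X →ₗ.[ℂ] X} {ξ : ℝ} (hξ : 2 * Real.pi * ξ ∉ imagSpec A)
    (n : WithTop ℕ∞) : ContDiffAt ℝ n (freqResolv A) ξ := by
  have h1 : ContDiffAt ℝ n (fun ξ : ℝ => Complex.I * ((2 * Real.pi * ξ : ℝ) : ℂ)) ξ :=
    contDiffAt_const.mul (Complex.ofRealCLM.contDiff.contDiffAt.comp ξ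
      (by fun_prop : ContDiffAt ℝ n (fun ξ : ℝ => 2 * Real.pi * ξ) ξ))
  exact ((contDiffAt_resolv hξ n).restrict_scalars ℝ).comp ξ h1

theorem hasDerivAt_freqResolv {A : X →ₗ.[ℂ] X} {ξ : ℝ} (hξ : 2 * Real.pi * ξ ∉ imagSpec A) :
    HasDerivAt (freqResolv A) ((-(2 * Real.pi * Complex.I) : ℂ) • freqResolv A ξ ^ 2) ξ := by
  have h1 : HasDerivAt (fun ξ : ℝ => Complex.I * ((2 * Real.pi * ξ : ℝ) : ℂ))
      (Complex.I * ((2 * Real.pi * 1 : ℝ) : ℂ)) ξ :=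
    (((hasDerivAt_id ξ).const_mul (2 * Real.pi)).ofReal_comp).const_mul Complex.I
  have h2 := (hasDerivAt_resolv hξ).scomp ξ h1
  refine h2.congr_deriv ?_
  rw [smul_neg, neg_smul, freqResolv]
  congr 2
  push_cast
  ring

theorem hasDerivAt_freqResolv_pow {A : X →ₗ.[ℂ] X} {ξ : ℝ} (hξ : 2 * Real.pi * ξ ∉ imagSpec A)
    (n : ℕ) : HasDerivAt (fun ξ => freqResolv A ξ ^ (n + 1))
      (((n + 1) * -(2 * Real.pi * Complex.I) : ℂ) • freqResolv A ξ ^ (n + 2)) ξ := by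
  induction n with
  | zero => simpa using hasDerivAt_freqResolv hξ
  | succ n ih =>
    have h := ih.mul (hasDerivAt_freqResolv hξ)
    have e : (fun ξ => freqResolv A ξ ^ (n + 1 + 1))
        = (fun ξ => freqResolv A ξ ^ (n + 1)) * freqResolv A := by
      ext1 ξ
      exact pow_succ _ _
    rw [e]
    refine h.congr_deriv ?_
    rw [smul_mul_assoc, mul_smul_comm, ← pow_succ, ← pow_add, ← add_smul]
    push_cast
    congr 1
    ring

theorem isClosed_setOf_mem_imagSpec (A : X →ₗ.[ℂ] X) :
    IsClosed {ξ : ℝ | 2 * Real.pi * ξ ∈ imagSpec A} := by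
  rw [← isOpen_compl_iff, isOpen_iff_mem_nhds]
  intro ξ hξ
  have hc : Continuous fun ξ : ℝ => Complex.I * ((2 * Real.pi * ξ : ℝ) : ℂ) := by fun_prop
  filter_upwards [hc.continuousAt.eventually (eventually_isResolvent (A := A) hξ)] with η hη
  exact hη.1

/-- Where `ψ = 0`, differentiation only raises the power of the resolvent, so three derivatives of
the symbol are integrable as soon as its square is; this is where `θ > 1/2` enters. -/
theorem exists_integrable_fourier_eq_freqResolv {A : X →ₗ.[ℂ] X} {a : ℝ}
    (hK : imagSpec A ⊆ Ioo (-a) a) {θ : ℝ} (hθ : 1 / 2 < θ)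
    (hR : ∃ C : ℝ, ∀ t : ℝ, t ∉ Ioo (-a) a → |t| ^ θ * ‖resolv A (Complex.I * (t : ℂ))‖ ≤ C)
    {ψ : ℝ → ℝ} (hψ : ContDiff ℝ 3 ψ) (hψc : HasCompactSupport ψ)
    (hψ1 : ∀ ξ, 2 * Real.pi * ξ ∈ imagSpec A → ∀ᶠ η in 𝓝 ξ, ψ η = 1) :
    ∃ G : ℝ → X →L[ℂ] X, Integrable G ∧ ∀ ξ, 𝓕 G ξ = ((1 - ψ ξ : ℝ) : ℂ) • freqResolv A ξ := by
  obtain ⟨C, hC⟩ := hR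
  set r := freqResolv A
  set H : ℝ → X →L[ℂ] X := fun ξ => ((1 - ψ ξ : ℝ) : ℂ) • r ξ
  obtain ⟨b, hb1, hba, hbψ⟩ : ∃ b : ℝ, 1 ≤ b ∧ a ≤ b ∧ ∀ ξ, b < |ξ| → ψ ξ = 0 := by
    obtain ⟨b₀, hb₀⟩ := hψc.isCompact.isBounded.exists_norm_le
    refine ⟨max 1 (max a b₀), le_max_left _ _, (le_max_left _ _).trans (le_max_right _ _),
      fun ξ hξ => image_eq_zero_of_notMem_tsupport fun h => ?_⟩
    exact absurd (hb₀ ξ h) (not_le.mpr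
      (((le_max_right _ _).trans (le_max_right _ _)).trans_lt hξ))
  have hlarge : ∀ ξ, b < |ξ| → 2 * Real.pi * ξ ∉ Ioo (-a) a := fun ξ hξ h => by
    have h1 : |2 * Real.pi * ξ| < a := abs_lt.mpr h
    rw [abs_mul, abs_of_pos Real.two_pi_pos] at h1
    nlinarith [Real.pi_gt_three, abs_nonneg ξ]
  have hrb : ∀ ξ, b < |ξ| → ‖r ξ‖ ≤ |C| * |ξ| ^ (-θ) := fun ξ hξ => by
    have h1 := hC _ (hlarge ξ hξ)
    have hξ0 : 0 < |ξ| := by linarith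
    rw [Real.rpow_neg hξ0.le, ← div_eq_mul_inv, le_div_iff₀ (by positivity), mul_comm]
    refine le_trans ?_ (h1.trans (le_abs_self C))
    refine mul_le_mul_of_nonneg_right (Real.rpow_le_rpow hξ0.le ?_ (by linarith)) (norm_nonneg _)
    rw [abs_mul, abs_of_pos Real.two_pi_pos]
    nlinarith [Real.pi_gt_three]
  have hopen : IsOpen {ξ : ℝ | b < |ξ|} := isOpen_lt continuous_const continuous_abs
  -- Two factors supply the decay; the others are merely bounded, as `|ξ|^(-θ) ≤ 1` for `|ξ| ≥ 1`.
  have hpow : ∀ n : ℕ, ∀ ξ, b < |ξ| →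
      ‖r ξ ^ (n + 2)‖ ≤ |C| ^ (n + 2) * |ξ| ^ (-(2 * θ)) := fun n ξ hξ => by
    have hξ0 : 0 < |ξ| := by linarith
    have hle : |ξ| ^ (-θ) ≤ 1 := Real.rpow_le_one_of_one_le_of_nonpos (by linarith) (by linarith)
    calc ‖r ξ ^ (n + 2)‖ ≤ ‖r ξ‖ ^ (n + 2) := norm_pow_le' _ (by omega)
      _ ≤ (|C| * |ξ| ^ (-θ)) ^ (n + 2) := by gcongr; exact hrb ξ hξ
      _ = |C| ^ (n + 2) * (|ξ| ^ (-θ)) ^ (n + 2) := mul_pow _ _ _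
      _ ≤ |C| ^ (n + 2) * (|ξ| ^ (-θ)) ^ 2 := by
        exact mul_le_mul_of_nonneg_left
          (pow_le_pow_of_le_one (by positivity) hle (by omega : 2 ≤ n + 2)) (by positivity)
      _ = _ := by
        rw [← Real.rpow_natCast (|ξ| ^ (-θ)) 2, ← Real.rpow_mul hξ0.le]
        congr 2
        push_cast
        ring
  have hH : ContDiff ℝ 3 H := contDiff_iff_contDiffAt.mpr fun ξ => by
    by_cases hξ : 2 * Real.pi * ξ ∈ imagSpec A
    · refine (contDiffAt_const (c := (0 : X →L[ℂ] X))).congr_of_eventuallyEq ?_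
      filter_upwards [hψ1 ξ hξ] with η hη
      simp [H, hη]
    · have h1 : ContDiffAt ℝ 3 (fun ξ => ((1 - ψ ξ : ℝ) : ℂ)) ξ :=
        Complex.ofRealCLM.contDiff.contDiffAt.comp ξ (contDiff_const.sub hψ).contDiffAt
      exact h1.smul (contDiffAt_freqResolv hξ 3)
  have hH0 : EqOn H r {ξ | b < |ξ|} := fun ξ hξ => by simp [H, hbψ ξ hξ]
  have hstep : ∀ (f : ℝ → X →L[ℂ] X) (c : ℂ) (n : ℕ),
      EqOn f (fun ξ => c • r ξ ^ (n + 1)) {ξ | b < |ξ|} →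
      EqOn (deriv f) (fun ξ => (c * ((n + 1) * -(2 * Real.pi * Complex.I) : ℂ)) • r ξ ^ (n + 2))
        {ξ | b < |ξ|} := fun f c n hf ξ hξ => by
    have h1 := (hasDerivAt_freqResolv_pow (A := A) (ξ := ξ)
      (fun h => hlarge ξ hξ (hK h)) n).const_smul c
    rw [smul_smul] at h1
    refine Eq.trans (EventuallyEq.deriv_eq ?_) h1.deriv
    filter_upwards [hopen.mem_nhds hξ] with η hη using hf hη
  have hH1 := hstep H 1 0 (fun ξ hξ => by simpa using hH0 hξ)
  have hH2 := hstep (deriv H) _ 1 hH1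
  have hH3 := hstep (deriv (deriv H)) _ 2 hH2
  have hbound : ∀ (f : ℝ → X →L[ℂ] X) (c : ℂ) (n : ℕ),
      EqOn f (fun ξ => c • r ξ ^ (n + 2)) {ξ | b < |ξ|} → ∀ ξ, b < |ξ| →
      ‖f ξ‖ ≤ (‖c‖ * |C| ^ (n + 2)) * |ξ| ^ (-(2 * θ)) := fun f c n hf ξ hξ => by
    rw [hf hξ, norm_smul, mul_assoc]
    gcongr
    exact hpow n ξ hξ
  have hc1 : Continuous (deriv H) := hH.continuous_deriv (by norm_num)
  have hD1 : ContDiff ℝ 2 (deriv H) := by simpa using hH.iterate_deriv' 2 1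
  have hD2 : ContDiff ℝ 1 (deriv (deriv H)) := by simpa using hH.iterate_deriv' 1 2
  have hs : 1 < 2 * θ := by linarith
  -- Half of the surplus `2θ - 1` goes to the weight: the remaining exponent is at least `θ + 1/2 >
  -- 1`.
  have hε : 0 < min 1 (θ - 1 / 2) := lt_min one_pos (by linarith)
  have hlim : Tendsto H (cocompact ℝ) (𝓝 0) := by
    have h1 : Tendsto (fun ξ : ℝ => |C| * |ξ| ^ (-θ)) (cocompact ℝ) (𝓝 0) := by
      have := ((tendsto_rpow_neg_atTop (by linarith : 0 < θ)).comp
        (tendsto_norm_cocompact_atTop (E := ℝ))).const_mul |C|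
      simpa using this
    refine squeeze_zero_norm' ?_ h1
    filter_upwards [tendsto_norm_cocompact_atTop.eventually_gt_atTop b] with ξ hξ
    rw [hH0 hξ]
    exact hrb ξ hξ
  have hweight : Integrable fun ξ : ℝ => |ξ| ^ min 1 (θ - 1 / 2) * ‖deriv H ξ‖ := by
    have hcont : Continuous fun ξ : ℝ => |ξ| ^ min 1 (θ - 1 / 2) * ‖deriv H ξ‖ :=
      (continuous_abs.rpow_const fun _ => Or.inr hε.le).mul hc1.norm
    obtain ⟨C₁, hC₁⟩ : ∃ C₁, ∀ ξ, b < |ξ| → ‖deriv H ξ‖ ≤ C₁ * |ξ| ^ (-(2 * θ)) :=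
      ⟨_, hbound _ _ 0 hH1⟩
    refine integrable_of_norm_le_rpow hcont hb1 (C := C₁)
      (s := 2 * θ - min 1 (θ - 1 / 2)) (by linarith [min_le_right 1 (θ - 1 / 2)]) fun ξ hξ => ?_
    have hξ0 : 0 < |ξ| := by linarith
    rw [Real.norm_of_nonneg (by positivity), neg_sub, sub_eq_add_neg _ (2 * θ),
      Real.rpow_add hξ0]
    calc _ ≤ |ξ| ^ min 1 (θ - 1 / 2) * (C₁ * |ξ| ^ (-(2 * θ))) := by
          gcongr
          exact hC₁ ξ hξ
      _ = _ := by ring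
  obtain ⟨G, hG, hGH⟩ := exists_integrable_fourier_eq hH hlim
    (integrable_of_norm_le_rpow hc1 hb1 hs (hbound _ _ 0 hH1))
    (integrable_of_norm_le_rpow (hD1.continuous_deriv (by norm_num)) hb1 hs (hbound _ _ 1 hH2))
    (integrable_of_norm_le_rpow hD2.continuous_deriv_one hb1 hs (hbound _ _ 2 hH3))
    hε (min_le_left _ _) hweight
  exact ⟨G, hG, fun ξ => congrFun hGH ξ⟩

end UnboundedOp

/-! ### Integration over `[0, t]` as a convolution -/

section IntervalKernel

/-- The signed indicator of the interval between `0` and `t`. -/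
noncomputable def intervalKernel (t : ℝ) : ℝ → ℂ :=
  fun s => indicator (Ioc 0 t) 1 s - indicator (Ioc t 0) 1 s

theorem integrable_intervalKernel (t : ℝ) : Integrable (intervalKernel t) := by
  have h : ∀ a b : ℝ, Integrable (indicator (Ioc a b) (1 : ℝ → ℂ)) := fun a b =>
    (integrable_indicator_iff measurableSet_Ioc).mpr
      (integrableOn_const (C := (1 : ℂ)) measure_Ioc_lt_top.ne)
  exact (h 0 t).sub (h t 0)

theorem integral_intervalKernel_smul {E : Type*} [NormedAddCommGroup E] [NormedSpace ℂ E]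
    {g : ℝ → E} {t : ℝ} (hg : IntervalIntegrable g volume 0 t) :
    ∫ s, intervalKernel t s • g s = ∫ s in (0 : ℝ)..t, g s := by
  have h : ∀ a b : ℝ, (fun s => indicator (Ioc a b) (1 : ℝ → ℂ) s • g s)
      = indicator (Ioc a b) g := fun a b => by
    ext s
    by_cases hs : s ∈ Ioc a b <;> simp [hs]
  simp only [intervalKernel, sub_smul]
  rw [integral_sub, h, h, integral_indicator measurableSet_Ioc, integral_indicator measurableSet_Ioc,
    intervalIntegral]
  · rw [h]
    exact (integrable_indicator_iff measurableSet_Ioc).mpr hg.1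
  · rw [h]
    exact (integrable_indicator_iff measurableSet_Ioc).mpr hg.2

/-- The multiplied-out form includes `ξ = 0`. -/
theorem fourier_intervalKernel (t ξ : ℝ) :
    (2 * Real.pi * Complex.I * ξ) * 𝓕 (intervalKernel t) ξ = 1 - 𝐞 (-(t * ξ)) := by
  have h1 : 𝓕 (intervalKernel t) ξ
      = ∫ s in (0 : ℝ)..t, Complex.exp (-(2 * Real.pi * Complex.I * ξ) * s) := by
    rw [Real.fourier_real_eq_integral_exp_smul, ← integral_intervalKernel_smul
      (Continuous.intervalIntegrable (by fun_prop) _ _)]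
    refine integral_congr_ae (Eventually.of_forall fun s => ?_)
    simp only [smul_eq_mul]
    rw [mul_comm]
    congr 2
    push_cast
    ring
  rw [h1]
  rcases eq_or_ne ξ 0 with rfl | hξ
  · simp
  · have hc : -(2 * Real.pi * Complex.I * ξ) ≠ 0 := by
      simp [Real.pi_ne_zero, hξ]
    rw [integral_exp_mul_complex hc, Real.fourierChar_apply]
    have e : -(2 * Real.pi * Complex.I * ξ) * (t : ℂ)
        = ((2 * Real.pi * -(t * ξ) : ℝ) : ℂ) * Complex.I := by
      push_cast
      ring
    rw [e]
    generalize Complex.exp _ = E₁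
    simp only [Complex.ofReal_zero, mul_zero, Complex.exp_zero]
    rw [div_neg, mul_neg, mul_div_cancel₀ _ (neg_ne_zero.mp hc)]
    ring

variable {X : Type*} [NormedAddCommGroup X] [NormedSpace ℂ X]

/-- The kernel depends on the very point `t` of evaluation, so that each term of the mild equation
at time `t` becomes a convolution evaluated at `t`. -/
theorem scalarConv_intervalKernel {w : ℝ → X} (hw : LocallyIntegrable w volume) (t : ℝ) :
    scalarConv (intervalKernel t) w t = ∫ s in (0 : ℝ)..t, w s := by
  have hi : IntervalIntegrable (fun s => w (t - s)) volume 0 t := by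
    have h : IntervalIntegrable w volume t 0 :=
      (hw.integrableOn_isCompact isCompact_uIcc).intervalIntegrable
    simpa using h.comp_sub_left t
  refine (integral_intervalKernel_smul hi).trans ?_
  simp

theorem fourier_translate (G : ℝ → X →L[ℂ] X) (t ξ : ℝ) :
    𝓕 (fun s => G (-t + s)) ξ = (𝐞 (-(t * ξ)) : ℂ) • 𝓕 G ξ := by
  have h := congrFun (VectorFourier.fourierIntegral_comp_add_right 𝐞 volume (innerₗ ℝ) G (-t)) ξ
  have e : (innerₗ ℝ) (-t) ξ = -(t * ξ) := by simp [mul_comm]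
  rw [e] at h
  refine Eq.trans (congrArg (fun f : ℝ → X →L[ℂ] X => 𝓕 f ξ) ?_) h
  ext1 s
  exact congrArg G (add_comm _ _)

/-- The form needed for the mild equation with `A` replaced by a bounded resolvent `R`, so that it
can be tested on transforms of kernels. -/
theorem opConv_eq_of_fourier_linear_relation [CompleteSpace X] {P G T χ N : ℝ → X →L[ℂ] X}
    (hP : Integrable P) (hG : Integrable G) (hT : Integrable T) (hχ : Integrable χ)
    (hN : Integrable N) (R : X →L[ℂ] X) (z : ℂ)
    (hF : ∀ ξ, 𝓕 P ξ = R * (z • 𝓕 P ξ - (𝓕 G ξ - 𝓕 T ξ) - (𝓕 N ξ - 𝓕 χ ξ)))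
    {φ : ℝ → X} (hφ : MemLp φ ⊤ volume) (t : ℝ) :
    opConv P φ t = R (z • opConv P φ t - (opConv G φ t - opConv T φ t)
      - (opConv N φ t - opConv χ φ t)) := by
  have hzP : Integrable (z • P) := hP.smul z
  have hGT : Integrable (G - T) := hG.sub hT
  have hNχ : Integrable (N - χ) := hN.sub hχ
  have hQ1 : Integrable (z • P - (G - T)) := hzP.sub hGT
  have hQ : Integrable (z • P - (G - T) - (N - χ)) := hQ1.sub hNχ
  have hRQ : Integrable fun s => R * (z • P - (G - T) - (N - χ)) s := hQ.const_mul R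
  have hPQ := opConv_eq_of_fourier_eq hP hRQ (fun ξ => ?_) φ t
  · rwa [opConv_const_mul R hQ hφ, opConv_sub hQ1 hNχ hφ, opConv_sub hzP hGT hφ,
      opConv_sub hG hT hφ, opConv_sub hN hχ hφ, opConv_const_smul] at hPQ
  · rw [fourier_const_mul R hQ, fourier_sub_apply hQ1 hNχ, fourier_sub_apply hzP hGT,
      fourier_sub_apply hG hT, fourier_sub_apply hN hχ,
      show 𝓕 (z • P) ξ = z • 𝓕 P ξ from fourier_const_smul_apply z P ξ]
    exact hF ξ

end IntervalKernel

/-! ### The mild equation -/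

namespace UnboundedOp

variable {X : Type*} [NormedAddCommGroup X] [NormedSpace ℂ X]

theorem IsResolvent.exists_apply_eq {A : X →ₗ.[ℂ] X} {z : ℂ} {R : X →L[ℂ] X}
    (hR : IsResolvent A z R) {x y : X} (h : x = R y) :
    ∃ hx : x ∈ A.domain, A ⟨x, hx⟩ = z • x - y := by
  subst h
  obtain ⟨hx, e⟩ := hR.1 y
  exact ⟨hx, by rw [← sub_eq_iff_eq_add'.mpr (sub_eq_iff_eq_add.mp e)]⟩

/-- Writing `∫₀ᵗ u` as `R(z, A) y` yields both membership in `D(A)` and the value of `A`. Here `y =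
z ∫₀ᵗ u - (u(t) - u(0)) + ∫₀ᵗ φ`, the term containing `m * φ` being zero. -/
theorem isMildSolution_opConv [CompleteSpace X] {A : X →ₗ.[ℂ] X} {z : ℂ} (hz : z ∉ spec A)
    {ψ : ℝ → ℝ} (hψ1 : ∀ ξ, 2 * Real.pi * ξ ∈ imagSpec A → ψ ξ = 1)
    {G : ℝ → X →L[ℂ] X} (hG : Integrable G)
    (hGF : ∀ ξ, 𝓕 G ξ = ((1 - ψ ξ : ℝ) : ℂ) • freqResolv A ξ)
    {m : ℝ → ℂ} (hm : Integrable m) (hmF : ∀ ξ, 𝓕 m ξ = ψ ξ)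
    {φ : ℝ → X} (hφ : MemLp φ ⊤ volume) (hmφ : scalarConv m φ = 0) :
    IsMildSolution A φ (opConv G φ) := by
  have hu : Continuous (opConv G φ) := (uniformContinuous_opConv hG hφ).continuous
  have hφl : LocallyIntegrable φ volume := hφ.locallyIntegrable le_top
  refine ⟨hφl, hu, fun t => ?_⟩
  set R := resolv A z
  have hR : IsResolvent A z R := isResolvent_resolv hz
  have hχ := integrable_smul_one (X := X) (integrable_intervalKernel t)
  have hm1 := integrable_smul_one (X := X) hm
  set χ : ℝ → X →L[ℂ] X := fun s => intervalKernel t s • 1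
  set M : ℝ → X →L[ℂ] X := fun s => m s • 1
  have hτ : Integrable fun s => G (-t + s) := hG.comp_add_left (-t)
  have hP : Integrable (χ ⋆[ContinuousLinearMap.mul ℂ (X →L[ℂ] X)] G) :=
    hχ.integrable_convolution _ hG
  have hχM : Integrable (χ ⋆[ContinuousLinearMap.mul ℂ (X →L[ℂ] X)] M) :=
    hχ.integrable_convolution _ hm1
  set P := χ ⋆[ContinuousLinearMap.mul ℂ (X →L[ℂ] X)] G
  set N := χ ⋆[ContinuousLinearMap.mul ℂ (X →L[ℂ] X)] M
  set T : ℝ → X →L[ℂ] X := fun s => G (-t + s)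
  have hPφ : opConv P φ t = ∫ s in (0 : ℝ)..t, opConv G φ s := by
    rw [opConv_convolution hχ hG hφ]
    exact scalarConv_intervalKernel hu.locallyIntegrable t
  have hNφ : opConv N φ t = 0 := by
    have hMφ : opConv M φ = 0 := hmφ
    rw [opConv_convolution hχ hm1 hφ, hMφ, opConv_zero]
    rfl
  have hχφ : opConv χ φ t = ∫ s in (0 : ℝ)..t, φ s := scalarConv_intervalKernel hφl t
  have hTφ : opConv T φ t = opConv G φ 0 := by
    rw [opConv_translate, neg_add_cancel]
  have hU := opConv_eq_of_fourier_linear_relation hP hG hτ hχ hχM R z (fun ξ => ?_) hφ t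
  · rw [hPφ, hNφ, hχφ, hTφ] at hU
    obtain ⟨hx, e⟩ := hR.exists_apply_eq hU
    refine ⟨hx, ?_⟩
    rw [e]
    abel
  · rw [fourier_mul_convolution hχ hG, fourier_mul_convolution hχ hm1, fourier_translate,
      fourier_smul_const, fourier_smul_const, hmF, hGF]
    have hk := fourier_intervalKernel t ξ
    have he : (𝐞 (-(t * ξ)) : ℂ) = 1 - (2 * Real.pi * Complex.I * ξ) * 𝓕 (intervalKernel t) ξ := by
      rw [hk]
      ring
    rw [he]
    generalize 𝓕 (intervalKernel t) ξ = c
    -- On the spectrum `ψ = 1`, so `G` has transform 0 and `M` has transform 1, and both sides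
    -- vanish. Elsewhere the relation is `(1 - ψ) c` times the resolvent identity.
    by_cases hξ : 2 * Real.pi * ξ ∈ imagSpec A
    · rw [hψ1 ξ hξ]
      simp
    · have hr : freqResolv A ξ = R + (z - 2 * Real.pi * Complex.I * ξ) • (R * freqResolv A ξ) := by
        refine ((isResolvent_resolv hξ).eq_add hR).trans ?_
        rw [freqResolv]
        congr 2
        push_cast
        ring
      simp only [smul_mul_assoc, mul_smul_comm, mul_sub, one_mul, mul_one]
      nth_rewrite 1 [hr]
      generalize R * freqResolv A ξ = V
      push_cast
      module

end UnboundedOp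

/-! ### The cutoff and the conclusion -/

theorem exists_smooth_cutoff {K F : Set ℝ} {a : ℝ} (hK : IsClosed K) (hF : IsClosed F)
    (hKa : K ⊆ Ioo (-a) a) (hFK : F ⊆ Kᶜ) :
    ∃ ψ : ℝ → ℝ, ContDiff ℝ (⊤ : ℕ∞) ψ ∧ HasCompactSupport ψ ∧
      (∀ ξ ∈ K, ∀ᶠ η in 𝓝 ξ, ψ η = 1) ∧ ∀ ξ ∈ tsupport ψ, ξ ∉ F := by
  -- Adding the complement of the interval to the zero set makes the support compact.
  have hd : Disjoint (F ∪ (Ioo (-a) a)ᶜ) K := by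
    rw [Set.disjoint_left]
    rintro x (hx | hx) hxK
    · exact hFK hx hxK
    · exact hx (hKa hxK)
  obtain ⟨ψ, h0, h1, -⟩ := exists_contMDiffMap_zero_one_nhds_of_isClosed
    (modelWithCornersSelf ℝ ℝ) (n := ⊤) (hF.union isOpen_Ioo.isClosed_compl) hK hd
  rw [eventually_nhdsSet_iff_forall] at h0 h1
  refine ⟨ψ, ψ.contMDiff.contDiff, ?_, h1, fun ξ hξ hξF => ?_⟩
  · refine HasCompactSupport.intro (isCompact_Icc (a := -a) (b := a)) fun x hx => ?_
    exact (h0 x (Or.inr fun h => hx (Ioo_subset_Icc_self h))).self_of_nhds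
  · exact notMem_tsupport_iff_eventuallyEq.mpr (h0 ξ (Or.inl hξF)) hξ

theorem theorem5p2 {X : Type*} [NormedAddCommGroup X] [NormedSpace ℂ X] [CompleteSpace X]
    (S : C0Semigroup X) (a : ℝ) (ha : 0 < a)
    (hK : UnboundedOp.imagSpec S.generator ⊆ Set.Ioo (-a) a)
    (θ : ℝ) (hθ : 1 / 2 < θ)
    (hR : ∃ C : ℝ, ∀ t : ℝ, t ∉ Set.Ioo (-a) a →
      |t| ^ θ * ‖UnboundedOp.resolv S.generator (Complex.I * (t : ℂ))‖ ≤ C)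
    (F : Set ℝ) (hF : IsClosed F) (hFK : F ⊆ (UnboundedOp.imagSpec S.generator)ᶜ) :
    ∃ G : ℝ → X →L[ℂ] X, Integrable G volume ∧
      ∀ φ : ℝ → X, MemLp φ ⊤ volume → beurlingSpectrum φ ⊆ F →
        (∀ t : ℝ, Integrable (fun s : ℝ => G s (φ (t - s))) volume) ∧
        UnboundedOp.IsMildSolution S.generator φ (opConv G φ) ∧
        (∃ M : ℝ, ∀ t : ℝ, ‖opConv G φ t‖ ≤ M) ∧
        UniformContinuous (opConv G φ) ∧
        beurlingSpectrum (opConv G φ) ⊆ beurlingSpectrum φ := by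
  have hscale : Continuous fun ξ : ℝ => 2 * Real.pi * ξ := by fun_prop
  have hpos := Real.two_pi_pos
  obtain ⟨ψ, hψ, hψc, hψ1, hψF⟩ := exists_smooth_cutoff (a := a / (2 * Real.pi))
    (UnboundedOp.isClosed_setOf_mem_imagSpec S.generator) (hF.preimage hscale)
    (fun ξ hξ => by
      have h := hK hξ
      rw [Set.mem_Ioo, neg_div', div_lt_iff₀ hpos, lt_div_iff₀ hpos, mul_comm ξ]
      exact h)
    (fun ξ hξ => hFK hξ)
  obtain ⟨G, hG, hGF⟩ := UnboundedOp.exists_integrable_fourier_eq_freqResolv hK hθ hR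
    (by exact_mod_cast contDiff_infty.mp hψ 3) hψc hψ1
  -- Any point off the spectrum would serve; `ia` is one because the interval containing `K` is
  -- open.
  have hz : Complex.I * (a : ℂ) ∉ UnboundedOp.spec S.generator := fun h => (hK h).2.ne rfl
  have hk₁ : HasCompactSupport (Complex.ofRealCLM ∘ ψ) := hψc.comp_left rfl
  have hk₂ : ContDiff ℝ (⊤ : ℕ∞) (Complex.ofRealCLM ∘ ψ) := by fun_prop
  set k : 𝓢(ℝ, ℂ) := hk₁.toSchwartzMap hk₂
  refine ⟨G, hG, fun φ hφ hsp => ⟨integrable_opConv_integrand hG hφ, ?_,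
    ⟨_, norm_opConv_le hG hφ⟩, uniformContinuous_opConv hG hφ,
    beurlingSpectrum_opConv_subset hG hφ⟩⟩
  refine UnboundedOp.isMildSolution_opConv hz (fun ξ hξ => (hψ1 ξ hξ).self_of_nhds) hG hGF
    (m := (𝓕⁻ k : 𝓢(ℝ, ℂ))) (SchwartzMap.integrable _) (fun ξ => ?_) hφ ?_
  · rw [← SchwartzMap.fourier_coe, FourierTransform.fourier_fourierInv_eq]
    rfl
  · refine scalarConv_fourierInv_eq_zero hφ k hk₁ fun ξ hξ h => hψF ξ ?_ (hsp h)
    refine closure_mono (fun x hx => ?_) hξ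
    rw [Function.mem_support] at hx ⊢
    intro h0
    apply hx
    change (ψ x : ℂ) = 0
    rw [h0, Complex.ofReal_zero]
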